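/- Throughout, for a countable first-order language $\mathcal L$, $\mathrm{Mod}(\mathcal L)$ is the standard Borel space of $\mathcal L$-structures with domain $\omega$. An $\mathcal L_{\omega_1\omega}$-elementary class is the set $\mathcal C\subseteq \mathrm{Mod}(\mathcal L)$ of all models of some sentence of the infinitary logic $\mathcal L_{\omega_1\omega}$, and $\cong_{\mathcal C}$ is the relation of isomorphism on $\mathcal C$; relations of this form are called isomorphism relations (spaces being identified up to Borel isomorphism). For equivalence relations $E$, $F$ on standard Borel spaces $X$, $Y$: $E\sim_B F$ (Borel bireducibility) means that there are Borel maps $X\to Y$ and $Y\to X$ reducing $E$ to $F$ and $F$ to $E$ respectively, where $f\colon X\to Y$ reduces $E$ to $F$ if $x\,E\,y\iff f(x)\,F\,f(y)$ for all $x,y\in X$; and $E\simeq_{cB}F$ (classwise Borel isomorphism) means that such reductions can be chosen so that the induced maps $X/E\to Y/F$ and $Y/F\to X/E$ are mutually inverse bijections. $E$ is a quasi-isomorphism relation if $E\sim_B{\cong_{\mathcal C}}$ for some countable language $\mathcal L$ and some $\mathcal L_{\omega_1\omega}$-elementary class $\mathcal C$. A weak-epimorphism is a surjective map between structures that preserves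 functions and relations from the domain structure to the range structure. $\hat{\mathcal L}$ is the language of graphs, with one binary relation symbol. **Corollary 4.2.** For every quasi-isomorphism relation $E$ on a standard Borel space there is an $\hat{\mathcal L}_{\omega_1\omega}$-elementary class $\hat{\mathcal C}$ consisting of connected graphs (with vertex set $\omega$) such that $E\sim_B{\cong_{\hat{\mathcal C}}}$ and, for all $z_1,z_2\in\hat{\mathcal C}$, there is a weak-epimorphism of $z_2$ onto $z_1$. In fact, if $E$ itself is an isomorphism relation, then $\hat{\mathcal C}$ can moreover be chosen so that $E\simeq_{cB}{\cong_{\hat{\mathcal C}}}$. -/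

import Mathlib

/-! ### Borel reducibility between equivalence relations -/

/-- `E ≤_B F`: there is a Borel `f : X → Y` with `x E y ↔ f x F f y`. -/
def BorelReducible {X Y : Type*} [MeasurableSpace X] [MeasurableSpace Y]
    (E : Setoid X) (F : Setoid Y) : Prop :=
  ∃ f : X → Y, Measurable f ∧ ∀ x y, E x y ↔ F (f x) (f y)

/-- `E ∼_B F`: Borel bireducibility. -/
def BorelBireducible {X Y : Type*} [MeasurableSpace X] [MeasurableSpace Y]
    (E : Setoid X) (F : Setoid Y) : Prop :=
  BorelReducible E F ∧ BorelReducible F E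

/-- `E ≃_cB F`: classwise Borel isomorphism, i.e. there are Borel reductions of `E` to `F` and of
`F` to `E` whose induced maps on the quotient spaces are inverse bijections. -/
def ClasswiseBorelIsomorphic {X Y : Type*} [MeasurableSpace X] [MeasurableSpace Y]
    (E : Setoid X) (F : Setoid Y) : Prop :=
  ∃ (f : X → Y) (g : Y → X), Measurable f ∧ Measurable g ∧
    (∀ x x', E x x' ↔ F (f x) (f x')) ∧ (∀ y y', F y y' ↔ E (g y) (g y')) ∧
    (∀ x, E (g (f x)) x) ∧ (∀ y, F (f (g y)) y)

/-! ### The infinitary logic `L_{ω₁ω}` -/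

/-- Formulas of `L_{ω₁ω}` with free variables among `x₀, …, x_{n-1}`; `all` binds the last
variable. Negation, countable conjunctions and universal quantification generate the remaining
connectives, and finite conjunctions are obtained by repetition. (A subformula of a sentence has
only finitely many free variables, so every sentence of `L_{ω₁ω}` is covered.) -/
inductive InfFormula (L : FirstOrder.Language.{0, 0}) : ℕ → Type
  | equal {n : ℕ} (s t : L.Term (Fin n)) : InfFormula L n
  | rel {n k : ℕ} (R : L.Relations k) (ts : Fin k → L.Term (Fin n)) : InfFormula L n
  | neg {n : ℕ} (φ : InfFormula L n) : InfFormula L n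
  | conj {n : ℕ} (φ : ℕ → InfFormula L n) : InfFormula L n
  | all {n : ℕ} (φ : InfFormula L (n + 1)) : InfFormula L n

/-- Tarskian truth of a formula of `L_{ω₁ω}` in a structure under an assignment. -/
def InfFormula.Realize {L : FirstOrder.Language.{0, 0}} {M : Type} [L.Structure M] :
    {n : ℕ} → InfFormula L n → (Fin n → M) → Prop
  | _, .equal s t, v => s.realize v = t.realize v
  | _, .rel R ts, v => FirstOrder.Language.Structure.RelMap R (fun i => (ts i).realize v)
  | _, .neg φ, v => ¬ φ.Realize v
  | _, .conj φ, v => ∀ i, (φ i).Realize v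
  | _, .all φ, v => ∀ a : M, φ.Realize (Fin.snoc v a : Fin _ → M)

/-- Sentences of `L_{ω₁ω}`. -/
abbrev InfSentence (L : FirstOrder.Language.{0, 0}) : Type := InfFormula L 0

/-! ### The space of countable structures -/

/-- `Mod(L)`: the space of `L`-structures with domain `ω`. -/
def ModSpace (L : FirstOrder.Language.{0, 0}) : Type := L.Structure ℕ

/-- The product σ-algebra of `Mod(L)`, generated by the evaluations of the function and relation
symbols at tuples. For countable `L` it is the Borel σ-algebra of the usual Polish topology,
the product of countably many discrete spaces. -/
instance (L : FirstOrder.Language.{0, 0}) : MeasurableSpace (ModSpace L) :=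
  MeasurableSpace.comap
    (fun S : ModSpace L =>
      ((fun p => S.funMap p.2.1 p.2.2 : (Σ k : ℕ, L.Functions k × (Fin k → ℕ)) → ℕ),
       (fun p => S.RelMap p.2.1 p.2.2 : (Σ k : ℕ, L.Relations k × (Fin k → ℕ)) → Prop)))
    inferInstance

/-- The structure `S` on `ω` satisfies the sentence `φ`. -/
def ModSpace.Models {L : FirstOrder.Language.{0, 0}} (S : ModSpace L) (φ : InfSentence L) : Prop :=
  letI : L.Structure ℕ := S
  φ.Realize (default : Fin 0 → ℕ)

/-- The `L_{ω₁ω}`-elementary class axiomatized by `φ`, with the σ-algebra induced by `Mod(L)`. -/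
abbrev ElementaryClass {L : FirstOrder.Language.{0, 0}} (φ : InfSentence L) : Type :=
  {S : ModSpace L // S.Models φ}

/-- Isomorphism of structures on `ω`. -/
def ModSpace.Isomorphic {L : FirstOrder.Language.{0, 0}} (S T : ModSpace L) : Prop :=
  Nonempty (@FirstOrder.Language.Equiv L ℕ ℕ S T)

/-- The isomorphism relation on the elementary class axiomatized by `φ`. -/
def isoRel {L : FirstOrder.Language.{0, 0}} (φ : InfSentence L) : Setoid (ElementaryClass φ) where
  r S T := S.1.Isomorphic T.1
  iseqv :=
    { refl := fun S => ⟨@FirstOrder.Language.Equiv.refl L ℕ S.1⟩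
      symm := fun {S T} h =>
        h.elim fun e => ⟨@FirstOrder.Language.Equiv.symm L ℕ ℕ S.1 T.1 e⟩
      trans := fun {S T U} h h' => h.elim fun e => h'.elim fun e' =>
        ⟨@FirstOrder.Language.Equiv.comp L ℕ ℕ S.1 T.1 ℕ U.1 e' e⟩ }

/-- `S ≼^wepi T`: there is a weak-epimorphism of `T` onto `S`, i.e. a surjection which preserves
functions and relations in the direction from `T` to `S`. -/
def ModSpace.WeakEpiImage {L : FirstOrder.Language.{0, 0}} (S T : ModSpace L) : Prop :=
  ∃ h : @FirstOrder.Language.Hom L ℕ ℕ T S,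
    Function.Surjective (@FirstOrder.Language.Hom.toFun L ℕ ℕ T S h)

/-- The structure `S` in the language with one binary relation symbol is a connected
(simple, undirected) graph. -/
def ModSpace.IsConnectedGraph (S : ModSpace FirstOrder.Language.graph) : Prop :=
  ∃ G : SimpleGraph ℕ, G.Connected ∧
    ∀ a b : ℕ, S.RelMap FirstOrder.Language.adj ![a, b] ↔ G.Adj a b

/-! ### Isomorphism and quasi-isomorphism relations -/

/-- `E` is an isomorphism relation: up to a Borel isomorphism of the underlying spaces, it is the
relation of isomorphism on an `L_{ω₁ω}`-elementary class, for some countable language `L`. -/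
def IsIsomorphismRelation {X : Type*} [MeasurableSpace X] (E : Setoid X) : Prop :=
  ∃ (L : FirstOrder.Language.{0, 0}) (_ : Countable L.Symbols) (φ : InfSentence L)
    (e : X ≃ᵐ ElementaryClass φ), ∀ x y, E x y ↔ isoRel φ (e x) (e y)

/-- `E` is a quasi-isomorphism relation: it is Borel bireducible with the relation of isomorphism
on an `L_{ω₁ω}`-elementary class, for some countable language `L`. -/
def IsQuasiIsomorphismRelation {X : Type*} [MeasurableSpace X] (E : Setoid X) : Prop :=
  ∃ (L : FirstOrder.Language.{0, 0}) (_ : Countable L.Symbols) (φ : InfSentence L),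
    BorelBireducible E (isoRel φ)

/-! A structure on `ω` is coded by a graph. Over `ω` one forms all iterated unordered pairs, joins
each pair to its members, and attaches a leaf to every node that codes a tuple at which some symbol
holds. Tuples are iterated Kuratowski pairs, padded with singletons up to a level that determines
the symbol (`exists_level`). The graph recovers its own levels: level `0` by a property of
neighbours (`lev_zero_nodeVertex`), the others by recursion. Thus "being a tower that codes a model
of `φ`" is expressible by one sentence of `L_{ω₁ω}` in the language of graphs (`dfn_codes`), and
this sentence axiomatizes the desired class.

The tower axioms are categorical over level `0`: towers with the same marks over a common base are
isomorphic, by matching nodes level by level (`Tower.nonempty_relIso`). Conversely, a graph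
determines the structure it codes up to isomorphism (`Decodes.nonempty_equiv`). Coding is therefore
a bijection between isomorphism classes. Borel maps `encode` and `decode` realize it in the two
directions, which gives the classwise Borel isomorphism.

For weak epimorphisms the coded structure is irrelevant. Edges of a tower join consecutive heights,
so the height maps it homomorphically onto a ray (`Tower.exists_height`). A connected graph on `ω`
has an infinite walk through all its vertices, that is, it is a homomorphic image of the ray
(`exists_surjective_walk`). Composing, every tower maps onto every connected graph on `ω`, in
particular onto every tower on `ω`. -/

/-! ### Definability by formulas of `L_{ω₁ω}` in the language of graphs -/

namespace GraphCoding

open FirstOrder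

/-- The structure in the language of graphs given by a binary relation. -/
@[reducible]
def relStructure {W : Type} (r : W → W → Prop) : Language.graph.Structure W where
  funMap f := nomatch f
  RelMap | .adj => fun x => r (x 0) (x 1)

/-- The binary relation of a structure in the language of graphs. -/
def edge (S : ModSpace Language.graph) : ℕ → ℕ → Prop :=
  fun a b => S.RelMap Language.adj ![a, b]

theorem relStructure_edge (S : ModSpace Language.graph) :
    (relStructure (edge S) : Language.graph.Structure ℕ) = S := by
  refine Language.Structure.ext ?_ ?_
  · funext n f
    exact nomatch f
  · funext n R x
    cases R
    change S.RelMap Language.adj ![x 0, x 1] = S.RelMap Language.adj x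
    congr 1
    funext i
    fin_cases i <;> rfl

/-- Families of `n`-ary predicates on all sets with a binary relation. -/
abbrev PredFamily (n : ℕ) : Type 1 := (W : Type) → (W → W → Prop) → (Fin n → W) → Prop

/-- Uniform definability by a formula of `L_{ω₁ω}`. -/
def Dfn {n : ℕ} (P : PredFamily n) : Prop :=
  ∃ θ : InfFormula Language.graph n, ∀ (W : Type) (r : W → W → Prop) (v : Fin n → W),
    @InfFormula.Realize _ W (relStructure r) n θ v ↔ P W r v

namespace Dfn

variable {n : ℕ}

theorem congr {P Q : PredFamily n} (h : Dfn P) (hPQ : ∀ W r v, P W r v ↔ Q W r v) : Dfn Q := by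
  obtain ⟨θ, hθ⟩ := h
  exact ⟨θ, fun W r v => (hθ W r v).trans (hPQ W r v)⟩

theorem adj (i j : Fin n) : Dfn (fun _ r v => r (v i) (v j)) :=
  ⟨.rel Language.adj ![Language.Term.var i, Language.Term.var j], fun _ _ _ => Iff.rfl⟩

theorem eq (i j : Fin n) : Dfn (fun _ _ v => v i = v j) :=
  ⟨.equal (Language.Term.var i) (Language.Term.var j), fun _ _ _ => Iff.rfl⟩

theorem not {P : PredFamily n} (h : Dfn P) : Dfn (fun W r v => ¬ P W r v) := by
  obtain ⟨θ, hθ⟩ := h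
  exact ⟨.neg θ, fun W r v => not_congr (hθ W r v)⟩

theorem all {P : (W : Type) → (W → W → Prop) → (Fin n → W) → W → Prop}
    (h : Dfn (n := n + 1) (fun W r v => P W r (Fin.init v) (v (Fin.last n)))) :
    Dfn (fun W r v => ∀ a, P W r v a) := by
  obtain ⟨θ, hθ⟩ := h
  refine ⟨.all θ, fun W r v => forall_congr' fun a => (hθ W r _).trans ?_⟩
  beta_reduce
  rw [Fin.init_snoc, Fin.snoc_last]

theorem ex {P : (W : Type) → (W → W → Prop) → (Fin n → W) → W → Prop}
    (h : Dfn (n := n + 1) (fun W r v => P W r (Fin.init v) (v (Fin.last n)))) :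
    Dfn (fun W r v => ∃ a, P W r v a) :=
  (all (P := fun W r v a => ¬ P W r v a) h.not).not.congr fun _ _ _ => by simp

theorem top : Dfn (n := n) (fun _ _ _ => True) :=
  -- For `n = 0` there is no free variable to equate, so the quantifier supplies one.
  (all (P := fun _ _ _ a => a = a) (eq _ _)).congr fun _ _ _ => by simp

theorem const (p : Prop) : Dfn (n := n) (fun _ _ _ => p) := by
  by_cases hp : p
  · exact top.congr fun _ _ _ => by simp [hp]
  · exact top.not.congr fun _ _ _ => by simp [hp]

theorem iall {ι : Type*} [Countable ι] {P : ι → PredFamily n} (h : ∀ i, Dfn (P i)) :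
    Dfn (fun W r v => ∀ i, P i W r v) := by
  rcases isEmpty_or_nonempty ι with hι | hι
  · exact top.congr fun _ _ _ => by simp
  · obtain ⟨u, hu⟩ := exists_surjective_nat ι
    choose θ hθ using h
    exact ⟨.conj fun k => θ (u k), fun W r v =>
      (forall_congr' fun k => hθ (u k) W r v).trans
        (hu.forall (p := fun i => P i W r v)).symm⟩

theorem iex {ι : Type*} [Countable ι] {P : ι → PredFamily n} (h : ∀ i, Dfn (P i)) :
    Dfn (fun W r v => ∃ i, P i W r v) :=
  (iall fun i => (h i).not).not.congr fun _ _ _ => by simp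

theorem and {P Q : PredFamily n} (hP : Dfn P) (hQ : Dfn Q) :
    Dfn (fun W r v => P W r v ∧ Q W r v) :=
  (iall (ι := Bool) (P := fun b => if b then P else Q)
    (by rintro (_ | _) <;> simpa)).congr fun _ _ _ => by simp [and_comm]

theorem or {P Q : PredFamily n} (hP : Dfn P) (hQ : Dfn Q) :
    Dfn (fun W r v => P W r v ∨ Q W r v) :=
  (hP.not.and hQ.not).not.congr fun _ _ _ => by tauto

theorem imp {P Q : PredFamily n} (hP : Dfn P) (hQ : Dfn Q) :
    Dfn (fun W r v => P W r v → Q W r v) :=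
  (hP.not.or hQ).congr fun _ _ _ => by tauto

theorem iff {P Q : PredFamily n} (hP : Dfn P) (hQ : Dfn Q) :
    Dfn (fun W r v => P W r v ↔ Q W r v) :=
  ((hP.imp hQ).and (hQ.imp hP)).congr fun _ _ _ => by tauto

theorem allTuple (k : ℕ) {P : (W : Type) → (W → W → Prop) → (Fin n → W) → (Fin k → W) → Prop}
    (h : Dfn (n := n + k) (fun W r v =>
      P W r (fun i => v (Fin.castAdd k i)) (fun j => v (Fin.natAdd n j)))) :
    Dfn (fun W r v => ∀ t, P W r v t) := by
  induction k with
  | zero =>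
    refine h.congr fun W r v => ⟨fun h t => ?_, fun h => ?_⟩
    · rwa [Subsingleton.elim t (fun j => v (Fin.natAdd n j))]
    · exact h _
  | succ k ih =>
    refine (ih (P := fun W r v t => ∀ a, P W r v (Fin.snoc (α := fun _ => W) t a)) ?_).congr ?_
    · refine all (h.congr fun W r v => ?_)
      refine Eq.to_iff (congrArg _ ?_)
      funext j
      refine Fin.lastCases ?_ (fun j => ?_) j
      · rw [Fin.snoc_last]; rfl
      · rw [Fin.snoc_castSucc]; rfl
    · intro W r v
      refine ⟨fun h t => ?_, fun h t a => h _⟩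
      simpa only [Fin.snoc_init_self] using h (Fin.init t) (t (Fin.last k))

theorem exTuple (k : ℕ) {P : (W : Type) → (W → W → Prop) → (Fin n → W) → (Fin k → W) → Prop}
    (h : Dfn (n := n + k) (fun W r v =>
      P W r (fun i => v (Fin.castAdd k i)) (fun j => v (Fin.natAdd n j)))) :
    Dfn (fun W r v => ∃ t, P W r v t) :=
  (allTuple k (P := fun W r v t => ¬ P W r v t) h.not).not.congr fun _ _ _ => by simp

end Dfn

/-! ### Invariance and measurability of definable predicates -/

theorem realize_equiv {L : FirstOrder.Language.{0, 0}} {M N : Type} [L.Structure M] [L.Structure N]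
    (e : M ≃[L] N) {n : ℕ} (θ : InfFormula L n) :
    ∀ v : Fin n → M, θ.Realize (fun i => e (v i)) ↔ θ.Realize v := by
  induction θ with
  | equal s t =>
    intro v
    change s.realize (e ∘ v) = t.realize (e ∘ v) ↔ s.realize v = t.realize v
    rw [Language.HomClass.realize_term, Language.HomClass.realize_term]
    exact e.injective.eq_iff
  | rel R ts =>
    intro v
    change Language.Structure.RelMap R (fun i => (ts i).realize (e ∘ v)) ↔
      Language.Structure.RelMap R (fun i => (ts i).realize v)
    simp only [Language.HomClass.realize_term]
    exact e.map_rel R _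
  | neg φ ih => exact fun v => not_congr (ih v)
  | conj φ ih => exact fun v => forall_congr' fun i => ih i v
  | all φ ih =>
    intro v
    refine (e.surjective.forall).trans (forall_congr' fun a => ?_)
    rw [← ih]
    refine Eq.to_iff (congrArg _ ?_)
    funext j
    refine Fin.lastCases ?_ (fun j => ?_) j <;> simp

/-- Bijections respecting binary relations, as isomorphisms of structures. -/
def relEquiv {W W' : Type} {r : W → W → Prop} {r' : W' → W' → Prop} (e : r ≃r r') :
    @Language.Equiv Language.graph W W' (relStructure r) (relStructure r') :=
  letI := relStructure r
  letI := relStructure r'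
  { toEquiv := e.toEquiv
    map_fun' := fun f => nomatch f
    map_rel' := fun R x => by
      cases R
      exact e.map_rel_iff }

theorem Dfn.invariant {n : ℕ} {P : PredFamily n} (h : Dfn P) {W W' : Type} {r : W → W → Prop}
    {r' : W' → W' → Prop} (e : r ≃r r') (v : Fin n → W) :
    P W' r' (fun i => e (v i)) ↔ P W r v := by
  obtain ⟨θ, hθ⟩ := h
  rw [← hθ, ← hθ]
  let := relStructure r
  let := relStructure r'
  exact realize_equiv (relEquiv e) θ v

theorem isomorphic_iff (S T : ModSpace Language.graph) :
    S.Isomorphic T ↔ Nonempty (edge S ≃r edge T) := by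
  constructor
  · rintro ⟨e⟩
    refine ⟨@Language.Equiv.toEquiv _ _ _ S T e, fun {a b} => ?_⟩
    have h := @Language.Equiv.map_rel' _ _ _ S T e 2 Language.adj ![a, b]
    refine Iff.trans (Eq.to_iff (congrArg (T.RelMap Language.adj) ?_)) h
    funext j
    fin_cases j <;> rfl
  · rintro ⟨e⟩
    have h := relEquiv e
    rw [relStructure_edge S, relStructure_edge T] at h
    exact ⟨h⟩

theorem measurable_modSpace {Y : Type*} [MeasurableSpace Y] {L : FirstOrder.Language.{0, 0}}
    {f : Y → ModSpace L}
    (hfun : ∀ (k : ℕ) (F : L.Functions k) (t : Fin k → ℕ) (a : ℕ),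
      MeasurableSet {y | (f y).funMap F t = a})
    (hrel : ∀ (k : ℕ) (R : L.Relations k) (t : Fin k → ℕ),
      MeasurableSet {y | (f y).RelMap R t}) : Measurable f := by
  refine measurable_comap_iff.2 (Measurable.prodMk ?_ ?_)
  · exact measurable_pi_lambda _ fun p => measurable_to_countable' fun a => hfun _ _ _ a
  · exact measurable_pi_lambda _ fun p => measurableSet_setOfPred.1 (hrel _ _ _)

theorem measurable_evaluations (L : FirstOrder.Language.{0, 0}) : Measurable
    (fun S : ModSpace L =>
      ((fun p => S.funMap p.2.1 p.2.2 : (Σ k : ℕ, L.Functions k × (Fin k → ℕ)) → ℕ),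
       (fun p => S.RelMap p.2.1 p.2.2 : (Σ k : ℕ, L.Relations k × (Fin k → ℕ)) → Prop))) :=
  comap_measurable _

theorem measurableSet_relMap {L : FirstOrder.Language.{0, 0}} {k : ℕ} (R : L.Relations k)
    (t : Fin k → ℕ) : MeasurableSet {S : ModSpace L | S.RelMap R t} :=
  measurableSet_setOfPred.2 ((measurable_pi_apply
    (X := fun _ : (Σ k : ℕ, L.Relations k × (Fin k → ℕ)) => Prop) ⟨k, R, t⟩).comp
      (measurable_snd.comp (measurable_evaluations L)))

theorem measurableSet_funMap {L : FirstOrder.Language.{0, 0}} {k : ℕ} (F : L.Functions k)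
    (t : Fin k → ℕ) (a : ℕ) : MeasurableSet {S : ModSpace L | S.funMap F t = a} :=
  ((measurable_pi_apply
    (X := fun _ : (Σ k : ℕ, L.Functions k × (Fin k → ℕ)) => ℕ) ⟨k, F, t⟩).comp
      (measurable_fst.comp (measurable_evaluations L))) (measurableSet_singleton a)

theorem measurableSet_edge (a b : ℕ) :
    MeasurableSet {S : ModSpace Language.graph | edge S a b} :=
  measurableSet_relMap _ _

/-- Induction on the formula: the domain is `ω`, so a quantifier becomes a countable intersection.
The language of graphs has no function symbols, hence every term is a variable. -/
theorem Dfn.measurableSet {n : ℕ} {P : PredFamily n} (h : Dfn P) (v : Fin n → ℕ) :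
    MeasurableSet {S : ModSpace Language.graph | P ℕ (edge S) v} := by
  obtain ⟨θ, hθ⟩ := h
  simp only [← hθ]
  clear hθ P
  induction θ with
  | equal s t =>
    cases s with
    | func F _ => exact nomatch F
    | var i =>
      cases t with
      | func F _ => exact nomatch F
      | var j => exact MeasurableSet.const (v i = v j)
  | rel R ts =>
    cases R
    have hv : ∀ {m : ℕ} (t : Language.graph.Term (Fin m)), ∃ i, t = Language.Term.var i := by
      intro m t
      cases t with
      | func F _ => exact nomatch F
      | var i => exact ⟨i, rfl⟩
    obtain ⟨i, hi⟩ := hv (ts 0)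
    obtain ⟨j, hj⟩ := hv (ts 1)
    convert measurableSet_edge (v i) (v j) using 3 with S
    change edge S (@Language.Term.realize _ _ (relStructure (edge S)) _ v (ts 0))
      (@Language.Term.realize _ _ (relStructure (edge S)) _ v (ts 1)) ↔ _
    rw [hi, hj]
    rfl
  | neg φ ih => exact (ih v).compl
  | conj φ ih =>
    simp only [InfFormula.Realize, Set.ofPred_forall]
    exact MeasurableSet.iInter fun i => ih i v
  | all φ ih =>
    simp only [InfFormula.Realize, Set.ofPred_forall]
    exact MeasurableSet.iInter fun a => ih _

end GraphCoding

/-! ### Towers of unordered pairs as graphs -/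

namespace GraphCoding

section Predicates

variable {W : Type} (r : W → W → Prop)

/-- The vertex `x` has exactly one neighbour. -/
def Leaf (x : W) : Prop := ∃ y, r x y ∧ ∀ z, r x z → z = y

/-- The vertex `x` is a node of level `n` of the tower. The nodes of level `0` are recognized by
the property that any two of their neighbours have a further common neighbour. -/
def Lev : ℕ → W → Prop
  | 0, x => ¬ Leaf r x ∧ ∀ y z, r x y → r x z → ¬ Leaf r y → ¬ Leaf r z →
      ∃ w, w ≠ x ∧ r w y ∧ r w z
  | 1, x => ¬ Leaf r x ∧ ∃ y, Lev 0 y ∧ r x y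
  -- A neighbour of a node of level `n + 1` lies on level `n` or `n + 2` unless it is a leaf, so it
  -- remains to exclude level `n`.
  | n + 2, x => ¬ Leaf r x ∧ ¬ Lev n x ∧ ∃ y, Lev (n + 1) y ∧ r x y

/-- The node `x` is the unordered pair of `y` and `z`. -/
def Pr (x y z : W) : Prop :=
  ∃ n, Lev r (n + 1) x ∧ Lev r n y ∧ Lev r n z ∧ ∀ w, Lev r n w → (r w x ↔ w = y ∨ w = z)

/-- The node `x` is the ordered pair of `y` and `z`. -/
def Kur (x y z : W) : Prop := ∃ p q, Pr r p y y ∧ Pr r q y z ∧ Pr r x p q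

/-- The node `x` is the `e`-fold iterated singleton of `y`. -/
def Lift : ℕ → W → W → Prop
  | 0, x, y => x = y
  | e + 1, x, y => ∃ u, Lift e u y ∧ Pr r x u u

/-- The node `x` codes the tuple `(a, t)`. -/
def Code : (k : ℕ) → W → W → (Fin k → W) → Prop
  | 0, x, a, _ => x = a
  | k + 1, x, a, t =>
      -- Pairs are formed only within one level. The code of the first `k` entries lies on level `2
      -- * k`, so the last entry is lifted there from level `0`; the Kuratowski pair adds two
      -- levels.
      ∃ y u, Code k y a (Fin.init t) ∧ Lift r (2 * k) u (t (Fin.last k)) ∧ Kur r x y u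

/-- The node `x` codes the tuple `(a, t)` at a level raised by `e`. -/
def Node (k e : ℕ) (x a : W) (t : Fin k → W) : Prop := ∃ y, Code r k y a t ∧ Lift r e x y

/-- The vertex `x` has a leaf attached to it. -/
def Marked (x : W) : Prop := ∃ l, Leaf r l ∧ r l x

/-- The node coding the tuple `(a, t)` at a level raised by `e` is marked. -/
def Mk (k e : ℕ) (a : W) (t : Fin k → W) : Prop := ∃ x, Node r k e x a t ∧ Marked r x

/-- The graph of a tower of unordered pairs over the nodes of level `0`, some of whose nodes have a
leaf attached. Only codes of tuples of the prescribed arities and levels have a leaf. -/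
structure Tower {ι : Type} (ar ε : ι → ℕ) : Prop where
  symm : ∀ x y, r x y → r y x
  irrefl : ∀ x, ¬ r x x
  not_leaf : ∀ x y, Leaf r x → r x y → ¬ Leaf r y
  leaf_unique : ∀ x y z, Leaf r x → Leaf r y → r x z → r y z → x = y
  exists_lev : ∀ x, ¬ Leaf r x → ∃ n, Lev r n x
  lev_unique : ∀ n m x, Lev r n x → Lev r m x → n = m
  lev_adj : ∀ n m x y, Lev r n x → Lev r m y → r x y → m = n + 1 ∨ n = m + 1
  exists_pr : ∀ n y z, Lev r n y → Lev r n z → ∃ x, Pr r x y z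
  pr_unique : ∀ x x' y z, Pr r x y z → Pr r x' y z → x = x'
  exists_eq_pr : ∀ n x, Lev r (n + 1) x → ∃ y z, Pr r x y z
  -- Infinitude of level `0`, phrased through finite tuples so as to be a countable conjunction of
  -- first-order statements.
  infinite : ∀ (k : ℕ) (t : Fin k → W), ∃ a, Lev r 0 a ∧ ∀ j, a ≠ t j
  marked : ∀ x, Marked r x → ∃ (i : ι) (a : W) (t : Fin (ar i) → W),
    Lev r 0 a ∧ (∀ j, Lev r 0 (t j)) ∧ Node r (ar i) (ε i) x a t

/-- The nodes of level `0` are enumerated by `e`, and the marks of the tower are given by the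
predicates `P`. -/
structure Decodes {ι M : Type} (ar ε : ι → ℕ) (P : (i : ι) → M → (Fin (ar i) → M) → Prop)
    (e : M → W) : Prop where
  injective : Function.Injective e
  lev_zero : ∀ x, Lev r 0 x ↔ ∃ m, e m = x
  mk_iff : ∀ i a t, Mk r (ar i) (ε i) (e a) (fun j => e (t j)) ↔ P i a t

end Predicates

section Basic

variable {W : Type} {r : W → W → Prop}

theorem Lev.node {n : ℕ} {x : W} (h : Lev r n x) : ¬ Leaf r x := by
  rcases n with _ | _ | n <;> exact h.1

theorem Pr.swap {x y z : W} (h : Pr r x y z) : Pr r x z y := by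
  obtain ⟨n, hx, hy, hz, h⟩ := h
  exact ⟨n, hx, hz, hy, fun w hw => (h w hw).trans or_comm⟩

theorem Pr.adj_left {x y z : W} (h : Pr r x y z) : r y x := by
  obtain ⟨n, hx, hy, hz, h⟩ := h
  exact (h y hy).2 (.inl rfl)

theorem Pr.adj_right {x y z : W} (h : Pr r x y z) : r z x := h.swap.adj_left

theorem Pr.of_lev {ι : Type} {ar ε : ι → ℕ} (T : Tower r ar ε) {n : ℕ} {x y z : W}
    (h : Pr r x y z) (hy : Lev r n y) :
    Lev r (n + 1) x ∧ Lev r n z ∧ ∀ w, Lev r n w → (r w x ↔ w = y ∨ w = z) := by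
  obtain ⟨m, hx, hy', hz, h⟩ := h
  obtain rfl := T.lev_unique _ _ _ hy hy'
  exact ⟨hx, hz, h⟩

theorem Pr.of_lev_succ {ι : Type} {ar ε : ι → ℕ} (T : Tower r ar ε) {n : ℕ} {x y z : W}
    (h : Pr r x y z) (hx : Lev r (n + 1) x) :
    Lev r n y ∧ Lev r n z ∧ ∀ w, Lev r n w → (r w x ↔ w = y ∨ w = z) := by
  obtain ⟨m, hx', hy, hz, h⟩ := h
  obtain rfl := Nat.succ_injective (T.lev_unique _ _ _ hx hx')
  exact ⟨hy, hz, h⟩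

end Basic

/-! ### Uniqueness of pairs and codes in a tower -/

namespace Tower

section Uniqueness

variable {W : Type} {r : W → W → Prop} {ι : Type} {ar ε : ι → ℕ}

/-- The members of a pair are exactly its neighbours on the level below, so they are determined up
to order. -/
theorem pr_eq_or (T : Tower r ar ε) {x y z y₁ z₁ : W} (h : Pr r x y z) (h₁ : Pr r x y₁ z₁) :
    y = y₁ ∧ z = z₁ ∨ y = z₁ ∧ z = y₁ := by
  obtain ⟨n, hx, hy, hz, h⟩ := h
  obtain ⟨hy₁, hz₁, h₁⟩ := h₁.of_lev_succ T hx
  have a := (h₁ y hy).1 ((h y hy).2 (.inl rfl))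
  have b := (h₁ z hz).1 ((h z hz).2 (.inr rfl))
  have c := (h y₁ hy₁).1 ((h₁ y₁ hy₁).2 (.inl rfl))
  have d := (h z₁ hz₁).1 ((h₁ z₁ hz₁).2 (.inr rfl))
  grind

theorem kur_unique (T : Tower r ar ε) {x x' y z : W} (h : Kur r x y z) (h' : Kur r x' y z) :
    x = x' := by
  obtain ⟨p, q, hp, hq, h⟩ := h
  obtain ⟨p', q', hp', hq', h'⟩ := h'
  obtain rfl := T.pr_unique _ _ _ _ hp hp'
  obtain rfl := T.pr_unique _ _ _ _ hq hq'
  exact T.pr_unique _ _ _ _ h h'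

theorem lift_unique (T : Tower r ar ε) {y : W} :
    ∀ {e : ℕ} {x x' : W}, Lift r e x y → Lift r e x' y → x = x'
  | 0, _, _, h, h' => Eq.trans h (Eq.symm h')
  | e + 1, _, _, ⟨u, hu, h⟩, ⟨u', hu', h'⟩ => by
    obtain rfl := T.lift_unique hu hu'
    exact T.pr_unique _ _ _ _ h h'

theorem code_unique (T : Tower r ar ε) {a : W} :
    ∀ {k : ℕ} {t : Fin k → W} {x x' : W}, Code r k x a t → Code r k x' a t → x = x'
  | 0, _, _, _, h, h' => Eq.trans h (Eq.symm h')
  | k + 1, _, _, _, ⟨y, u, hy, hu, h⟩, ⟨y', u', hy', hu', h'⟩ => by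
    obtain rfl := T.code_unique hy hy'
    obtain rfl := T.lift_unique hu hu'
    exact T.kur_unique h h'

theorem node_unique (T : Tower r ar ε) {k e : ℕ} {a x x' : W} {t : Fin k → W}
    (h : Node r k e x a t) (h' : Node r k e x' a t) : x = x' := by
  obtain ⟨y, hy, h⟩ := h
  obtain ⟨y', hy', h'⟩ := h'
  obtain rfl := T.code_unique hy hy'
  exact T.lift_unique h h'

end Uniqueness

end Tower

/-! ### Matching two towers over the same set -/

section Matching

variable {W W' M : Type} (r : W → W → Prop) (r' : W' → W' → Prop) (e : M → W) (e' : M → W')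

/-- The nodes `x` and `x'` of level `n` are built in the same way from corresponding nodes of
level `0`. -/
def Match : ℕ → W → W' → Prop
  | 0, x, x' => ∃ m, e m = x ∧ e' m = x'
  | n + 1, x, x' =>
      ∃ y z y' z', Match n y y' ∧ Match n z z' ∧ Pr r x y z ∧ Pr r' x' y' z'

/-- The extension of the matching of nodes to all vertices. -/
def FullMatch (x : W) (x' : W') : Prop :=
  (∃ n, Match r r' e e' n x x') ∨
    Leaf r x ∧ Leaf r' x' ∧ ∃ n y y', r x y ∧ r' x' y' ∧ Match r r' e e' n y y'

variable {r r' e e'}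

theorem Match.symm : ∀ {n : ℕ} {x : W} {x' : W'}, Match r r' e e' n x x' → Match r' r e' e n x' x
  | 0, _, _, ⟨m, h, h'⟩ => ⟨m, h', h⟩
  | _ + 1, _, _, ⟨_, _, _, _, hy, hz, h, h'⟩ => ⟨_, _, _, _, hy.symm, hz.symm, h', h⟩

theorem FullMatch.symm {x : W} {x' : W'} (h : FullMatch r r' e e' x x') :
    FullMatch r' r e' e x' x := by
  rcases h with ⟨n, h⟩ | ⟨h, h', n, y, y', hy, hy', hm⟩
  · exact .inl ⟨n, h.symm⟩
  · exact .inr ⟨h', h, n, y', y, hy', hy, hm.symm⟩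

variable {ι : Type} {ar ε : ι → ℕ} {P : (i : ι) → M → (Fin (ar i) → M) → Prop}

theorem Match.lev (T : Tower r ar ε) (D : Decodes r ar ε P e) :
    ∀ {n : ℕ} {x : W} {x' : W'}, Match r r' e e' n x x' → Lev r n x
  | 0, _, _, ⟨m, h, _⟩ => (D.lev_zero _).2 ⟨m, h⟩
  | _ + 1, _, _, ⟨_, _, _, _, hy, _, h, _⟩ => (h.of_lev T (hy.lev T D)).1

/-- By `Tower.pr_eq_or`, two decompositions of `x` agree up to order. Inductively so do those of the
partners, and `pr_unique` in the second tower identifies them. -/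
theorem Match.functional (T : Tower r ar ε) (T' : Tower r' ar ε) (D : Decodes r ar ε P e) :
    ∀ {n : ℕ} {x : W} {x' x'' : W'}, Match r r' e e' n x x' → Match r r' e e' n x x'' → x' = x''
  | 0, _, _, _, ⟨m, h, h'⟩, ⟨m₁, h₁, h₁'⟩ => by
    obtain rfl := D.injective (h.trans h₁.symm)
    exact h'.symm.trans h₁'
  | _ + 1, _, _, _, ⟨y, z, y', z', hy, hz, h, h'⟩, ⟨y₁, z₁, y₁', z₁', hy₁, hz₁, h₁, h₁'⟩ => by
    rcases T.pr_eq_or h h₁ with ⟨rfl, rfl⟩ | ⟨rfl, rfl⟩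
    · obtain rfl := hy.functional T T' D hy₁
      obtain rfl := hz.functional T T' D hz₁
      exact T'.pr_unique _ _ _ _ h' h₁'
    · obtain rfl := hy.functional T T' D hz₁
      obtain rfl := hz.functional T T' D hy₁
      exact T'.pr_unique _ _ _ _ h' h₁'.swap

theorem Match.exists_pr (T' : Tower r' ar ε) (D' : Decodes r' ar ε P e') {n : ℕ} {x y z : W} {y' z' : W'} (h : Pr r x y z)
    (hy : Match r r' e e' n y y') (hz : Match r r' e e' n z z') :
    ∃ x', Match r r' e e' (n + 1) x x' ∧ Pr r' x' y' z' := by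
  obtain ⟨x', hx'⟩ := T'.exists_pr n y' z' (hy.symm.lev T' D') (hz.symm.lev T' D')
  exact ⟨x', ⟨y, z, y', z', hy, hz, h, hx'⟩, hx'⟩

/-- Decompose `x` into its members, match these one level below, and form the pair of their
partners. -/
theorem Match.exists (T : Tower r ar ε) (T' : Tower r' ar ε) (D : Decodes r ar ε P e)
    (D' : Decodes r' ar ε P e') : ∀ {n : ℕ} {x : W}, Lev r n x → ∃ x', Match r r' e e' n x x'
  | 0, x, h => by
    obtain ⟨m, hm⟩ := (D.lev_zero x).1 h
    exact ⟨e' m, m, hm, rfl⟩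
  | n + 1, x, h => by
    obtain ⟨y, z, hx⟩ := T.exists_eq_pr n x h
    obtain ⟨hy, hz, -⟩ := hx.of_lev_succ T h
    obtain ⟨y', hy'⟩ := Match.exists T T' D D' hy
    obtain ⟨z', hz'⟩ := Match.exists T T' D D' hz
    obtain ⟨x', hx', -⟩ := Match.exists_pr T' D' hx hy' hz'
    exact ⟨x', hx'⟩

theorem Match.exists_lift (T : Tower r ar ε) (T' : Tower r' ar ε) (D : Decodes r ar ε P e)
    (D' : Decodes r' ar ε P e') {n : ℕ} {y : W} {y' : W'} (hy : Match r r' e e' n y y') :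
    ∀ {k : ℕ} {x : W}, Lift r k x y → ∃ x', Match r r' e e' (n + k) x x' ∧ Lift r' k x' y'
  | 0, x, h => ⟨y', by rwa [show x = y from h], rfl⟩
  | k + 1, x, ⟨u, hu, h⟩ => by
    obtain ⟨u', hm, hu'⟩ := Match.exists_lift T T' D D' hy hu
    obtain ⟨x', hx, hx'⟩ := Match.exists_pr T' D' h hm hm
    exact ⟨x', hx, u', hu', hx'⟩

theorem Match.exists_code (T : Tower r ar ε) (T' : Tower r' ar ε) (D : Decodes r ar ε P e)
    (D' : Decodes r' ar ε P e') {a : M} : ∀ {k : ℕ} {x : W} {t : Fin k → M},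
    Code r k x (e a) (fun j => e (t j)) →
      ∃ x', Match r r' e e' (2 * k) x x' ∧ Code r' k x' (e' a) (fun j => e' (t j))
  | 0, x, t, h => ⟨e' a, ⟨a, Eq.symm h, rfl⟩, rfl⟩
  | k + 1, x, t, ⟨y, u, hy, hu, p, q, hp, hq, hx⟩ => by
    obtain ⟨y', hmy, hy'⟩ := Match.exists_code (t := Fin.init t) T T' D D' hy
    obtain ⟨u', hmu, hu'⟩ := Match.exists_lift (n := 0) T T' D D'
      ⟨t (Fin.last k), rfl, rfl⟩ hu
    rw [Nat.zero_add] at hmu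
    obtain ⟨p', hmp, hp'⟩ := Match.exists_pr T' D' hp hmy hmy
    obtain ⟨q', hmq, hq'⟩ := Match.exists_pr T' D' hq hmy hmu
    obtain ⟨x', hmx, hx'⟩ := Match.exists_pr T' D' hx hmp hmq
    exact ⟨x', hmx, y', u', hy', hu', p', q', hp', hq', hx'⟩

/-- A marked node codes some tuple over level `0`. Its partner codes the corresponding tuple in the
other tower, and both towers are marked according to the same predicates `P`. -/
theorem Match.marked (T : Tower r ar ε) (T' : Tower r' ar ε) (D : Decodes r ar ε P e)
    (D' : Decodes r' ar ε P e') {n : ℕ} {x : W} {x' : W'} (h : Match r r' e e' n x x')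
    (hx : Marked r x) : Marked r' x' := by
  obtain ⟨i, a, t, ha, ht, y, hy, hl⟩ := T.marked x hx
  obtain ⟨a, rfl⟩ := (D.lev_zero a).1 ha
  choose t' ht' using fun j => (D.lev_zero (t j)).1 (ht j)
  obtain rfl : (fun j => e (t' j)) = t := funext ht'
  obtain ⟨y', hmy, hy'⟩ := Match.exists_code T T' D D' hy
  obtain ⟨x₁, hmx, hl'⟩ := Match.exists_lift T T' D D' hmy hl
  obtain rfl := T.lev_unique _ _ _ (h.lev T D) (hmx.lev T D)
  obtain rfl := h.functional T T' D hmx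
  obtain ⟨x₂, hx₂, hmark⟩ := (D'.mk_iff i a t').2 ((D.mk_iff i a t').1 ⟨x, ⟨y, hy, hl⟩, hx⟩)
  obtain rfl := T'.node_unique hx₂ ⟨y', hy', hl'⟩
  exact hmark

/-- Adjacent nodes lie on consecutive levels, where adjacency is membership in a pair, which
matching preserves. -/
theorem Match.adj (T : Tower r ar ε) (T' : Tower r' ar ε) (D : Decodes r ar ε P e) {n m : ℕ} {x y : W} {x' y' : W'} (hx : Match r r' e e' n x x')
    (hy : Match r r' e e' m y y') (h : r x y) : r' x' y' := by
  have key : ∀ {n x y x' y'}, Match r r' e e' n x x' → Match r r' e e' (n + 1) y y' → r x y →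
      r' x' y' := by
    rintro n x y x' y' hx ⟨u, v, u', v', hu, hv, hp, hp'⟩ h
    rcases ((hp.of_lev T (hu.lev T D)).2.2 x (hx.lev T D)).1 h with rfl | rfl
    · obtain rfl := hx.functional T T' D hu
      exact hp'.adj_left
    · obtain rfl := hx.functional T T' D hv
      exact hp'.adj_right
  rcases T.lev_adj _ _ _ _ (hx.lev T D) (hy.lev T D) h with rfl | rfl
  · exact key hx hy h
  · exact T'.symm _ _ (key hy hx (T.symm _ _ h))

theorem Leaf.eq_of_adj {x y z : W} (h : Leaf r x) (hy : r x y) (hz : r x z) : y = z := by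
  obtain ⟨w, _, hw⟩ := h
  exact (hw y hy).trans (hw z hz).symm

theorem FullMatch.functional (T : Tower r ar ε) (T' : Tower r' ar ε) (D : Decodes r ar ε P e)
    {x : W} {x' x'' : W'} (h : FullMatch r r' e e' x x') (h' : FullMatch r r' e e' x x'') :
    x' = x'' := by
  rcases h with ⟨n, h⟩ | ⟨h, hl, n, y, y', hy, hy', hm⟩ <;>
    rcases h' with ⟨m, k⟩ | ⟨k, kl, m, z, z', hz, hz', hm'⟩
  · obtain rfl := T.lev_unique _ _ _ (h.lev T D) (k.lev T D)
    exact h.functional T T' D k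
  · exact absurd k (h.lev T D).node
  · exact absurd h (k.lev T D).node
  · obtain rfl := h.eq_of_adj hy hz
    obtain rfl := T.lev_unique _ _ _ (hm.lev T D) (hm'.lev T D)
    obtain rfl := hm.functional T T' D hm'
    exact T'.leaf_unique _ _ _ hl kl hy' hz'

theorem FullMatch.exists (T : Tower r ar ε) (T' : Tower r' ar ε) (D : Decodes r ar ε P e)
    (D' : Decodes r' ar ε P e') (x : W) : ∃ x', FullMatch r r' e e' x x' := by
  by_cases hx : Leaf r x
  · obtain ⟨y, hy, -⟩ := id hx
    obtain ⟨n, hn⟩ := T.exists_lev y (T.not_leaf _ _ hx hy)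
    obtain ⟨y', hm⟩ := Match.exists T T' D D' hn
    obtain ⟨x', hx', hy'⟩ := hm.marked T T' D D' ⟨x, hx, hy⟩
    exact ⟨x', .inr ⟨hx, hx', n, y, y', hy, hy', hm⟩⟩
  · obtain ⟨n, hn⟩ := T.exists_lev x hx
    obtain ⟨x', hx'⟩ := Match.exists T T' D D' hn
    exact ⟨x', .inl ⟨n, hx'⟩⟩

theorem FullMatch.adj (T : Tower r ar ε) (T' : Tower r' ar ε) (D : Decodes r ar ε P e) {x y : W} {x' y' : W'} (h : FullMatch r r' e e' x x')
    (k : FullMatch r r' e e' y y') (hxy : r x y) : r' x' y' := by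
  rcases id h with ⟨n, hn⟩ | ⟨hx, hx', n, z, z', hz, hz', hm⟩
  · rcases k with ⟨m, hm⟩ | ⟨hy, hy', m, z, z', hz, hz', hm⟩
    · exact hn.adj T T' D hm hxy
    · obtain rfl := hy.eq_of_adj hz (T.symm _ _ hxy)
      obtain rfl := h.functional T T' D (.inl ⟨m, hm⟩)
      exact T'.symm _ _ hz'
  · obtain rfl := hx.eq_of_adj hz hxy
    obtain rfl := k.functional T T' D (.inl ⟨n, hm⟩)
    exact hz'

/-- A tower is determined up to isomorphism by the predicates which it codes. -/
theorem Tower.nonempty_relIso (T : Tower r ar ε) (T' : Tower r' ar ε) (D : Decodes r ar ε P e)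
    (D' : Decodes r' ar ε P e') : Nonempty (r ≃r r') := by
  choose f hf using FullMatch.exists T T' D D'
  choose g hg using FullMatch.exists T' T D' D
  exact ⟨{
    toFun := f
    invFun := g
    left_inv := fun x => (hg (f x)).functional T' T D' (hf x).symm
    right_inv := fun x => (hf (g x)).functional T T' D (hg x).symm
    map_rel_iff' := fun {x y} => ⟨(hf x).symm.adj T' T D' (hf y).symm,
      (hf x).adj T T' D (hf y)⟩ }⟩

end Matching

end GraphCoding

/-! ### Weak epimorphisms between towers -/

namespace GraphCoding

section WeakEpi

/-- In a connected graph there is an infinite walk through all vertices. -/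
theorem exists_surjective_walk {G : SimpleGraph ℕ} (hG : G.Connected) :
    ∃ w : ℕ → ℕ, (∀ n, G.Adj (w n) (w (n + 1))) ∧ Function.Surjective w := by
  have step : ∀ v t, v ≠ t → ∃ u, G.Adj v u ∧ G.dist u t < G.dist v t := by
    intro v t hvt
    obtain ⟨p, hp⟩ := (hG.preconnected v t).exists_walk_length_eq_dist
    cases p with
    | nil => exact absurd rfl hvt
    | cons h q =>
      refine ⟨_, h, ?_⟩
      rw [← hp, SimpleGraph.Walk.length_cons]
      exact Nat.lt_succ_of_le (SimpleGraph.dist_le q)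
  -- The walk must not pause, even at its target: there any neighbour will do, and one exists
  -- because the graph is connected with more than one vertex.
  have step' : ∀ v t, ∃ u, G.Adj v u ∧ (v ≠ t → G.dist u t < G.dist v t) := by
    intro v t
    by_cases hvt : v = t
    · obtain ⟨u, hu, -⟩ := step v (v + 1) (Nat.succ_ne_self v).symm
      exact ⟨u, hu, fun h => absurd hvt h⟩
    · obtain ⟨u, hu, hd⟩ := step v t hvt
      exact ⟨u, hu, fun _ => hd⟩
  choose next hadj hdist using step'
  -- The state consists of the current vertex and the current target; once target `t` is reached,
  -- the next target is `t + 1`.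
  let s : ℕ → ℕ × ℕ := fun n =>
    Nat.rec (0, 0) (fun _ p => (next p.1 p.2, if p.1 = p.2 then p.2 + 1 else p.2)) n
  have hs : ∀ n, s (n + 1) =
      (next (s n).1 (s n).2, if (s n).1 = (s n).2 then (s n).2 + 1 else (s n).2) := fun n => rfl
  -- The distance to a fixed target drops at every step until the target is hit.
  have reach : ∀ d n, G.dist (s n).1 (s n).2 ≤ d → ∃ m, s m = ((s n).2, (s n).2) := by
    intro d
    induction d with
    | zero =>
      intro n hn
      exact ⟨n, Prod.ext (hG.dist_eq_zero_iff.1 (Nat.le_zero.1 hn)) rfl⟩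
    | succ d ih =>
      intro n hn
      by_cases h : (s n).1 = (s n).2
      · exact ⟨n, Prod.ext h rfl⟩
      · have h2 : (s (n + 1)).2 = (s n).2 := by rw [hs, if_neg h]
        have h1 : (s (n + 1)).1 = next (s n).1 (s n).2 := by rw [hs]
        have := ih (n + 1) (by
          rw [h1, h2]
          exact Nat.lt_succ_iff.1 ((hdist _ _ h).trans_le hn))
        rwa [h2] at this
  refine ⟨fun n => (s n).1, fun n => ?_, fun t => ?_⟩
  · exact hadj _ _
  · suffices h : ∃ n, s n = (t, t) by
      obtain ⟨n, hn⟩ := h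
      exact ⟨n, congrArg Prod.fst hn⟩
    induction t with
    | zero => exact ⟨0, rfl⟩
    | succ t ih =>
      obtain ⟨n, hn⟩ := ih
      have h2 : (s (n + 1)).2 = t + 1 := by rw [hs, hn, if_pos rfl]
      have := reach _ (n + 1) le_rfl
      rwa [h2] at this

/-! ### Height, connectedness and homomorphisms of towers -/

namespace Tower

variable {W : Type} {r : W → W → Prop} {ι : Type} {ar ε : ι → ℕ}

theorem exists_lev_eq (T : Tower r ar ε) (n : ℕ) : ∃ x, Lev r n x := by
  induction n with
  | zero => exact (T.infinite 0 Fin.elim0).imp fun _ h => h.1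
  | succ n ih =>
    obtain ⟨y, hy⟩ := ih
    obtain ⟨x, hx⟩ := T.exists_pr n y y hy hy
    exact ⟨x, (hx.of_lev T hy).1⟩

/-- The level function is a homomorphism of a tower onto a ray. -/
theorem exists_height (T : Tower r ar ε) : ∃ h : W → ℕ,
    (∀ x y, r x y → h y = h x + 1 ∨ h x = h y + 1) ∧ Function.Surjective h := by
  -- A leaf is placed one above the node carrying it.
  have H : ∀ x, ∃ n, (¬ Leaf r x → Lev r n x) ∧
      (Leaf r x → ∃ m y, r x y ∧ Lev r m y ∧ n = m + 1) := by
    intro x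
    by_cases hx : Leaf r x
    · obtain ⟨y, hy, -⟩ := id hx
      obtain ⟨m, hm⟩ := T.exists_lev y (T.not_leaf _ _ hx hy)
      exact ⟨m + 1, fun h => absurd hx h, fun _ => ⟨m, y, hy, hm, rfl⟩⟩
    · obtain ⟨n, hn⟩ := T.exists_lev x hx
      exact ⟨n, fun _ => hn, fun h => absurd h hx⟩
  choose h hnode hleaf using H
  have key : ∀ x y, r x y → Leaf r x → h x = h y + 1 := by
    intro x y hxy hx
    obtain ⟨m, z, hz, hm, heq⟩ := hleaf x hx
    obtain rfl := hx.eq_of_adj hxy hz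
    rw [heq, T.lev_unique _ _ _ hm (hnode _ (T.not_leaf _ _ hx hxy))]
  refine ⟨h, fun x y hxy => ?_, fun n => ?_⟩
  · by_cases hx : Leaf r x
    · exact .inr (key x y hxy hx)
    · by_cases hy : Leaf r y
      · exact .inl (key y x (T.symm _ _ hxy) hy)
      · exact T.lev_adj _ _ _ _ (hnode x hx) (hnode y hy) hxy
  · obtain ⟨x, hx⟩ := T.exists_lev_eq n
    exact ⟨x, T.lev_unique _ _ _ (hnode x hx.node) hx⟩

/-- The simple graph underlying a tower. -/
def toGraph (T : Tower r ar ε) : SimpleGraph W where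
  Adj := r
  symm := ⟨T.symm⟩
  loopless := ⟨T.irrefl⟩

/-- Descend from a pair to one of its members. Connectedness then follows, since two nodes of level
`0` are joined through their pair. -/
theorem reachable_lev_zero (T : Tower r ar ε) (x : W) :
    ∃ a, Lev r 0 a ∧ T.toGraph.Reachable x a := by
  have H : ∀ n x, Lev r n x → ∃ a, Lev r 0 a ∧ T.toGraph.Reachable x a := by
    intro n
    induction n with
    | zero => exact fun x hx => ⟨x, hx, SimpleGraph.Reachable.refl x⟩
    | succ n ih =>
      intro x hx
      obtain ⟨y, z, h⟩ := T.exists_eq_pr n x hx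
      obtain ⟨a, ha, hr⟩ := ih y (h.of_lev_succ T hx).1
      exact ⟨a, ha, (SimpleGraph.Adj.reachable (G := T.toGraph) h.adj_left).symm.trans hr⟩
  by_cases hx : Leaf r x
  · obtain ⟨y, hy, -⟩ := id hx
    obtain ⟨n, hn⟩ := T.exists_lev y (T.not_leaf _ _ hx hy)
    obtain ⟨a, ha, hr⟩ := H n y hn
    exact ⟨a, ha, (SimpleGraph.Adj.reachable (G := T.toGraph) hy).trans hr⟩
  · obtain ⟨n, hn⟩ := T.exists_lev x hx
    exact H n x hn

theorem connected (T : Tower r ar ε) : T.toGraph.Connected := by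
  have : Nonempty W := (T.exists_lev_eq 0).nonempty
  refine ⟨fun x y => ?_⟩
  obtain ⟨a, ha, hxa⟩ := T.reachable_lev_zero x
  obtain ⟨b, hb, hyb⟩ := T.reachable_lev_zero y
  obtain ⟨c, hc⟩ := T.exists_pr 0 a b ha hb
  exact hxa.trans (((SimpleGraph.Adj.reachable (G := T.toGraph) hc.adj_left).trans
    (SimpleGraph.Adj.reachable (G := T.toGraph) hc.adj_right).symm).trans hyb.symm)

/-- Follow the height by a walk through all of `G`: consecutive heights go to consecutive, hence
adjacent, vertices of the walk. -/
theorem exists_hom (T : Tower r ar ε) {G : SimpleGraph ℕ} (hG : G.Connected) :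
    ∃ f : W → ℕ, (∀ x y, r x y → G.Adj (f x) (f y)) ∧ Function.Surjective f := by
  obtain ⟨h, hh, hsurj⟩ := T.exists_height
  obtain ⟨w, hw, hwsurj⟩ := exists_surjective_walk hG
  refine ⟨w ∘ h, fun x y hxy => ?_, hwsurj.comp hsurj⟩
  rcases hh x y hxy with e | e
  · simpa only [Function.comp_apply, e] using hw (h x)
  · simpa only [Function.comp_apply, e] using (hw (h y)).symm

end Tower

theorem isConnectedGraph_of_tower {ι : Type} {ar ε : ι → ℕ}
    {S : ModSpace FirstOrder.Language.graph} (T : Tower (edge S) ar ε) : S.IsConnectedGraph :=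
  ⟨T.toGraph, T.connected, fun _ _ => Iff.rfl⟩

theorem weakEpiImage_of_tower {ι ι' : Type} {ar ε : ι → ℕ} {ar' ε' : ι' → ℕ}
    {S S' : ModSpace FirstOrder.Language.graph}
    (T : Tower (edge S) ar ε) (T' : Tower (edge S') ar' ε') : S.WeakEpiImage S' := by
  obtain ⟨f, hf, hsurj⟩ := T'.exists_hom T.connected
  refine ⟨@FirstOrder.Language.Hom.mk _ _ _ S' S f (fun F => nomatch F) ?_, hsurj⟩
  intro n R x hx
  cases R
  have e : ∀ y : Fin 2 → ℕ, y = ![y 0, y 1] := fun y => by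
    funext i
    fin_cases i <;> rfl
  rw [e x] at hx
  rw [e (f ∘ x)]
  exact hf _ _ hx

end WeakEpi

end GraphCoding

/-! ### Translation of sentences -/

namespace GraphCoding

open FirstOrder

section Translation

variable {L : FirstOrder.Language.{0, 0}}

/-- The arity of a symbol. -/
@[reducible]
def arity : L.Symbols → ℕ
  | .inl F => F.1
  | .inr R => R.1

/-- The predicate coded for a symbol: the graph of a function, or a relation which ignores the
first argument. -/
def Holds {M : Type} (S : L.Structure M) : (s : L.Symbols) → M → (Fin (arity s) → M) → Prop
  | .inl F, a, t => S.funMap F.2 t = a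
  | .inr R, _, t => S.RelMap R.2 t

variable (ε : L.Symbols → ℕ) {W : Type} (r : W → W → Prop)

/-- The node `x` is the value of a term in the coded structure. -/
def TermVal {n : ℕ} (v : Fin n → W) : L.Term (Fin n) → W → Prop
  | .var i, x => x = v i
  | @Language.Term.func _ _ k F ts, x => Lev r 0 x ∧ ∃ b : Fin k → W,
      (∀ j, Lev r 0 (b j) ∧ TermVal v (ts j) (b j)) ∧ Mk r k (ε (.inl ⟨k, F⟩)) x b

/-- Truth in the coded structure. -/
def Sat : {n : ℕ} → InfFormula L n → (Fin n → W) → Prop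
  | _, .equal s t, v => ∃ x, TermVal ε r v s x ∧ TermVal ε r v t x
  | _, @InfFormula.rel _ _ k R ts, v => ∃ b : Fin k → W,
      (∀ j, Lev r 0 (b j) ∧ TermVal ε r v (ts j) (b j)) ∧
        ∃ a, Lev r 0 a ∧ Mk r k (ε (.inr ⟨k, R⟩)) a b
  | _, .neg φ, v => ¬ Sat φ v
  | _, .conj φ, v => ∀ i, Sat (φ i) v
  | _, .all φ, v => ∀ a, Lev r 0 a → Sat φ (Fin.snoc v a : Fin _ → W)

/-- The graph is a tower coding a structure which satisfies `φ`. -/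
structure Codes (φ : InfSentence L) : Prop where
  tower : Tower r arity ε
  exists_fun : ∀ (F : Σ k, L.Functions k) (t : Fin F.1 → W), (∀ j, Lev r 0 (t j)) →
    ∃ a, Lev r 0 a ∧ Mk r F.1 (ε (.inl F)) a t
  fun_unique : ∀ (F : Σ k, L.Functions k) (t : Fin F.1 → W) (a b : W), (∀ j, Lev r 0 (t j)) →
    Lev r 0 a → Lev r 0 b → Mk r F.1 (ε (.inl F)) a t → Mk r F.1 (ε (.inl F)) b t → a = b
  rel_congr : ∀ (R : Σ k, L.Relations k) (t : Fin R.1 → W) (a b : W), (∀ j, Lev r 0 (t j)) →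
    Lev r 0 a → Lev r 0 b → Mk r R.1 (ε (.inr R)) a t → Mk r R.1 (ε (.inr R)) b t
  sat : Sat ε r φ default

variable {ε r}

section

variable {M : Type} {S : L.Structure M} {e : M → W}

theorem Decodes.lev (D : Decodes r arity ε (Holds S) e) (m : M) : Lev r 0 (e m) :=
  (D.lev_zero _).2 ⟨m, rfl⟩

theorem Decodes.termVal_iff (D : Decodes r arity ε (Holds S) e) {n : ℕ} (v : Fin n → M)
    (s : L.Term (Fin n)) : ∀ x, TermVal ε r (fun i => e (v i)) s x ↔ x = e (s.realize v) := by
  induction s with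
  | var i => exact fun x => Iff.rfl
  | @func k F ts ih =>
    intro x
    constructor
    · rintro ⟨hx, b, hb, h⟩
      obtain ⟨m, rfl⟩ := (D.lev_zero x).1 hx
      obtain rfl : b = fun j => e ((ts j).realize v) := funext fun j => (ih j _).1 (hb j).2
      have := (D.mk_iff (.inl ⟨k, F⟩) m (fun j => (ts j).realize v)).1 h
      exact congrArg e this.symm
    · rintro rfl
      exact ⟨D.lev _, fun j => e ((ts j).realize v), fun j => ⟨D.lev _, (ih j _).2 rfl⟩,
        (D.mk_iff (.inl ⟨k, F⟩) _ (fun j => (ts j).realize v)).2 rfl⟩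

/-- The quantifiers of `Sat` are relativized to level `0`, which `e` enumerates, and atomic formulas
are read off from the marks. -/
theorem Decodes.sat_iff [Nonempty M] (D : Decodes r arity ε (Holds S) e) {n : ℕ} (φ : InfFormula L n) :
    ∀ v : Fin n → M, Sat ε r φ (fun i => e (v i)) ↔ φ.Realize v := by
  induction φ with
  | equal s t =>
    intro v
    simp only [Sat, InfFormula.Realize, D.termVal_iff]
    simp only [exists_eq_left]
    exact D.injective.eq_iff
  | @rel n k R ts =>
    intro v
    simp only [Sat, InfFormula.Realize, D.termVal_iff]
    constructor
    · rintro ⟨b, hb, a, ha, h⟩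
      obtain ⟨m, rfl⟩ := (D.lev_zero a).1 ha
      obtain rfl : b = fun j => e ((ts j).realize v) := funext fun j => (hb j).2
      exact (D.mk_iff (.inr ⟨k, R⟩) m (fun j => (ts j).realize v)).1 h
    · intro h
      -- A relation ignores the first entry of the coded tuple, so any element can fill it.
      exact ⟨_, fun j => ⟨D.lev _, rfl⟩, e (Classical.arbitrary M), D.lev _,
        (D.mk_iff (.inr ⟨k, R⟩) _ (fun j => (ts j).realize v)).2 h⟩
  | neg φ ih => exact fun v => not_congr (ih v)
  | conj φ ih => exact fun v => forall_congr' fun i => ih i v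
  | all φ ih =>
    intro v
    simp only [Sat, InfFormula.Realize, D.lev_zero, forall_exists_index, forall_apply_eq_imp_iff]
    refine forall_congr' fun a => ?_
    rw [← ih]
    refine Eq.to_iff (congrArg _ ?_)
    funext j
    refine Fin.lastCases ?_ (fun j => ?_) j <;> simp

theorem Decodes.codes [Nonempty M] (T : Tower r arity ε) (D : Decodes r arity ε (Holds S) e)
    {φ : InfSentence L} {v : Fin 0 → M} (h : φ.Realize v) : Codes ε r φ where
  tower := T
  exists_fun F t ht := by
    choose u hu using fun j => (D.lev_zero _).1 (ht j)
    obtain rfl : (fun j => e (u j)) = t := funext hu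
    exact ⟨_, D.lev _, (D.mk_iff (.inl F) _ u).2 rfl⟩
  fun_unique F t a b ht ha hb hat hbt := by
    choose u hu using fun j => (D.lev_zero _).1 (ht j)
    obtain rfl : (fun j => e (u j)) = t := funext hu
    obtain ⟨m, rfl⟩ := (D.lev_zero _).1 ha
    obtain ⟨m', rfl⟩ := (D.lev_zero _).1 hb
    exact congrArg e (((D.mk_iff (.inl F) m u).1 hat).symm.trans ((D.mk_iff (.inl F) m' u).1 hbt))
  rel_congr R t a b ht ha hb hat := by
    choose u hu using fun j => (D.lev_zero _).1 (ht j)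
    obtain rfl : (fun j => e (u j)) = t := funext hu
    obtain ⟨m, rfl⟩ := (D.lev_zero _).1 ha
    obtain ⟨m', rfl⟩ := (D.lev_zero _).1 hb
    exact (D.mk_iff (.inr R) m' u).2 ((D.mk_iff (.inr R) m u).1 hat)
  sat := by
    rw [← D.sat_iff] at h
    rwa [Subsingleton.elim default fun i => e (v i)]

/-- Two structures coded by the same graph are isomorphic. -/
theorem Decodes.nonempty_equiv [Nonempty M] {M' : Type} {S' : L.Structure M'} {e' : M' → W}
    (D : Decodes r arity ε (Holds S) e) (D' : Decodes r arity ε (Holds S') e') :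
    Nonempty (M ≃[L] M') := by
  choose f hf using fun m => (D'.lev_zero _).1 (D.lev m)
  choose g hg using fun m => (D.lev_zero _).1 (D'.lev m)
  have key : ∀ (s : L.Symbols) a t, Holds S' s (f a) (fun j => f (t j)) ↔ Holds S s a t := by
    intro s a t
    rw [← D.mk_iff, ← D'.mk_iff]
    simp only [hf]
  exact ⟨{
    toFun := f
    invFun := g
    left_inv := fun m => D.injective ((hg _).trans (hf _))
    right_inv := fun m => D'.injective ((hf _).trans (hg _))
    map_fun' := fun {k} F t => ((key (.inl ⟨k, F⟩) _ t).2 rfl).symm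
    map_rel' := fun {k} R t => key (.inr ⟨k, R⟩) (Classical.arbitrary M) t }⟩

end

variable (ε r) in
/-- The structure coded by a graph, for an enumeration `e` of the nodes of level `0`. -/
@[reducible]
noncomputable def decodeStructure (e : ℕ → W) : L.Structure ℕ where
  -- If the graph satisfies `Codes` and `e` enumerates level `0` injectively, this set is a
  -- singleton; the infimum just extracts its element.
  funMap {k} F t := sInf {a | Mk r k (ε (.inl ⟨k, F⟩)) (e a) (fun j => e (t j))}
  RelMap {k} R t := ∃ a, Mk r k (ε (.inr ⟨k, R⟩)) (e a) (fun j => e (t j))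

theorem Codes.funMap_iff {φ : InfSentence L} (h : Codes ε r φ) {e : ℕ → W}
    (he : Function.Injective e) (hlev : ∀ x, Lev r 0 x ↔ ∃ m, e m = x) (F : Σ k, L.Functions k)
    (t : Fin F.1 → ℕ) (a : ℕ) :
    (decodeStructure ε r e).funMap F.2 t = a ↔
      Mk r F.1 (ε (.inl F)) (e a) (fun j => e (t j)) := by
  have hl : ∀ m, Lev r 0 (e m) := fun m => (hlev _).2 ⟨m, rfl⟩
  obtain ⟨x, hx, hmk⟩ := h.exists_fun F (fun j => e (t j)) (fun j => hl _)
  obtain ⟨b, rfl⟩ := (hlev x).1 hx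
  have hb : (decodeStructure ε r e).funMap F.2 t = b := by
    have : {a | Mk r F.1 (ε (.inl F)) (e a) (fun j => e (t j))} = {b} :=
      Set.ext fun a => ⟨fun ha => he (h.fun_unique F _ _ _ (fun j => hl _) (hl _) (hl _) ha hmk),
        fun ha => ha ▸ hmk⟩
    change sInf {a | Mk r F.1 (ε (.inl F)) (e a) (fun j => e (t j))} = b
    rw [this, csInf_singleton]
  rw [hb]
  exact ⟨fun hba => hba ▸ hmk, fun ha =>
    he (h.fun_unique F _ _ _ (fun j => hl _) (hl _) (hl _) hmk ha)⟩

theorem Codes.decodes {φ : InfSentence L} (h : Codes ε r φ) {e : ℕ → W}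
    (he : Function.Injective e) (hlev : ∀ x, Lev r 0 x ↔ ∃ m, e m = x) :
    Decodes r arity ε (Holds (decodeStructure ε r e)) e where
  injective := he
  lev_zero := hlev
  mk_iff s a t := by
    have hl : ∀ m, Lev r 0 (e m) := fun m => (hlev _).2 ⟨m, rfl⟩
    rcases s with F | R
    · exact (h.funMap_iff he hlev F t a).symm
    · exact ⟨fun ha => ⟨a, ha⟩, fun ⟨b, hb⟩ =>
        h.rel_congr R _ _ _ (fun j => hl _) (hl _) (hl _) hb⟩

end Translation

/-! ### Definability of the translation -/

section Definability

variable {n : ℕ}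

theorem dfn_leaf (i : Fin n) : Dfn (fun _ r v => Leaf r (v i)) :=
  .ex (.and (.adj _ _) (.all (.imp (.adj _ _) (.eq _ _))))

theorem dfn_lev (m : ℕ) : ∀ {n : ℕ} (i : Fin n), Dfn (fun _ r v => Lev r m (v i)) := by
  induction m using Nat.strong_induction_on with
  | _ m ih =>
    intro n i
    rcases m with _ | _ | m
    · exact .and (dfn_leaf _).not (.all (.all (.imp (.adj _ _) (.imp (.adj _ _)
        (.imp (dfn_leaf _).not (.imp (dfn_leaf _).not
          (.ex (.and (Dfn.eq _ _).not (.and (.adj _ _) (.adj _ _))))))))))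
    · exact .and (dfn_leaf _).not (.ex (.and (ih 0 (by omega) _) (.adj _ _)))
    · exact .and (dfn_leaf _).not (.and (ih m (by omega) _).not
        (.ex (.and (ih (m + 1) (by omega) _) (.adj _ _))))

theorem dfn_pr (i j k : Fin n) : Dfn (fun _ r v => Pr r (v i) (v j) (v k)) :=
  .iex fun _ => .and (dfn_lev _ _) (.and (dfn_lev _ _) (.and (dfn_lev _ _)
    (.all (.imp (dfn_lev _ _) (.iff (.adj _ _) (.or (.eq _ _) (.eq _ _)))))))

theorem dfn_kur (i j k : Fin n) : Dfn (fun _ r v => Kur r (v i) (v j) (v k)) :=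
  .ex (.ex (.and (dfn_pr _ _ _) (.and (dfn_pr _ _ _) (dfn_pr _ _ _))))

theorem dfn_lift (e : ℕ) : ∀ {n : ℕ} (i j : Fin n), Dfn (fun _ r v => Lift r e (v i) (v j)) := by
  induction e with
  | zero => exact fun i j => .eq i j
  | succ e ih => exact fun i j => .ex (.and (ih _ _) (dfn_pr _ _ _))

/-- The map `σ` selects the variables holding the tuple, which lets the induction pass under
quantifiers that shift the indices. -/
theorem dfn_code (k : ℕ) : ∀ {n : ℕ} (i j : Fin n) (σ : Fin k → Fin n),
    Dfn (fun _ r v => Code r k (v i) (v j) (fun l => v (σ l))) := by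
  induction k with
  | zero => exact fun i j _ => .eq i j
  | succ k ih =>
    exact fun i j σ => .ex (.ex (.and (ih _ _ (fun l => (σ l.castSucc).castSucc.castSucc))
      (.and (dfn_lift _ _ _) (dfn_kur _ _ _))))

theorem dfn_node (k e : ℕ) (i j : Fin n) (σ : Fin k → Fin n) :
    Dfn (fun _ r v => Node r k e (v i) (v j) (fun l => v (σ l))) :=
  .ex (.and (dfn_code k _ _ (fun l => (σ l).castSucc)) (dfn_lift _ _ _))

theorem dfn_marked (i : Fin n) : Dfn (fun _ r v => Marked r (v i)) :=
  .ex (.and (dfn_leaf _) (.adj _ _))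

theorem dfn_mk (k e : ℕ) (i : Fin n) (σ : Fin k → Fin n) :
    Dfn (fun _ r v => Mk r k e (v i) (fun l => v (σ l))) :=
  .ex (.and (dfn_node k e _ _ (fun l => (σ l).castSucc)) (dfn_marked _))

theorem dfn_tower {ι : Type} [Countable ι] (ar ε : ι → ℕ) :
    Dfn (n := n) (fun _ r _ => Tower r ar ε) := by
  have h : Dfn (n := n) (fun W r _ =>
      (∀ x y, r x y → r y x) ∧
      (∀ x, ¬ r x x) ∧
      (∀ x y, Leaf r x → r x y → ¬ Leaf r y) ∧
      (∀ x y z, Leaf r x → Leaf r y → r x z → r y z → x = y) ∧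
      (∀ x, ¬ Leaf r x → ∃ n, Lev r n x) ∧
      (∀ n m x, Lev r n x → Lev r m x → n = m) ∧
      (∀ n m x y, Lev r n x → Lev r m y → r x y → m = n + 1 ∨ n = m + 1) ∧
      (∀ n y z, Lev r n y → Lev r n z → ∃ x, Pr r x y z) ∧
      (∀ x x' y z, Pr r x y z → Pr r x' y z → x = x') ∧
      (∀ n x, Lev r (n + 1) x → ∃ y z, Pr r x y z) ∧
      (∀ (k : ℕ) (t : Fin k → W), ∃ a, Lev r 0 a ∧ ∀ j, a ≠ t j) ∧
      (∀ x, Marked r x → ∃ (i : ι) (a : W) (t : Fin (ar i) → W),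
        Lev r 0 a ∧ (∀ j, Lev r 0 (t j)) ∧ Node r (ar i) (ε i) x a t)) := by
    refine .and ?_ (.and ?_ (.and ?_ (.and ?_ (.and ?_ (.and ?_ (.and ?_ (.and ?_ (.and ?_
      (.and ?_ (.and ?_ ?_))))))))))
    · exact .all (.all (.imp (.adj _ _) (.adj _ _)))
    · exact .all (Dfn.adj _ _).not
    · exact .all (.all (.imp (dfn_leaf _) (.imp (.adj _ _) (dfn_leaf _).not)))
    · exact .all (.all (.all (.imp (dfn_leaf _) (.imp (dfn_leaf _)
        (.imp (.adj _ _) (.imp (.adj _ _) (.eq _ _)))))))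
    · exact .all (.imp (dfn_leaf _).not (.iex fun _ => dfn_lev _ _))
    · exact .iall fun _ => .iall fun _ => .all (.imp (dfn_lev _ _)
        (.imp (dfn_lev _ _) (.const _)))
    · exact .iall fun _ => .iall fun _ => .all (.all (.imp (dfn_lev _ _)
        (.imp (dfn_lev _ _) (.imp (.adj _ _) (.const _)))))
    · exact .iall fun _ => .all (.all (.imp (dfn_lev _ _)
        (.imp (dfn_lev _ _) (.ex (dfn_pr _ _ _)))))
    · exact .all (.all (.all (.all (.imp (dfn_pr _ _ _) (.imp (dfn_pr _ _ _) (.eq _ _))))))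
    · exact .iall fun _ => .all (.imp (dfn_lev _ _) (.ex (.ex (dfn_pr _ _ _))))
    · exact .iall fun k => .allTuple k (.ex (.and (dfn_lev _ _) (.iall fun j => (Dfn.eq _ _).not)))
    · exact .all (.imp (dfn_marked _) (.iex fun i => .ex (.exTuple (ar i)
        (.and (dfn_lev _ _) (.and (.iall fun j => dfn_lev _ _) (dfn_node _ _ _ _ _))))))
  exact h.congr fun W r _ =>
    ⟨fun ⟨h₁, h₂, h₃, h₄, h₅, h₆, h₇, h₈, h₉, h₁₀, h₁₁, h₁₂⟩ =>
      ⟨h₁, h₂, h₃, h₄, h₅, h₆, h₇, h₈, h₉, h₁₀, h₁₁, h₁₂⟩,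
    fun ⟨h₁, h₂, h₃, h₄, h₅, h₆, h₇, h₈, h₉, h₁₀, h₁₁, h₁₂⟩ =>
      ⟨h₁, h₂, h₃, h₄, h₅, h₆, h₇, h₈, h₉, h₁₀, h₁₁, h₁₂⟩⟩

variable {L : FirstOrder.Language.{0, 0}} (ε : L.Symbols → ℕ)

theorem dfn_termVal {m : ℕ} (s : L.Term (Fin m)) : ∀ {n : ℕ} (σ : Fin m → Fin n) (i : Fin n),
    Dfn (fun _ r v => TermVal ε r (fun j => v (σ j)) s (v i)) := by
  induction s with
  | var j => exact fun σ i => .eq i (σ j)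
  | @func k F ts ih =>
    exact fun σ i => .and (dfn_lev _ _) (.exTuple k (.and (.iall fun j => .and (dfn_lev _ _)
      (ih j (fun l => Fin.castAdd k (σ l)) _)) (dfn_mk _ _ _ _)))

theorem dfn_sat {n : ℕ} (φ : InfFormula L n) : Dfn (fun _ r v => Sat ε r φ v) := by
  induction φ with
  | equal s t =>
    exact .ex (.and (dfn_termVal ε s Fin.castSucc _) (dfn_termVal ε t Fin.castSucc _))
  | @rel n k R ts =>
    exact .exTuple k (.and (.iall fun j => .and (dfn_lev _ _)
      (dfn_termVal ε (ts j) (Fin.castAdd k) _)) (.ex (.and (dfn_lev _ _)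
        (dfn_mk _ _ _ (fun j => (Fin.natAdd n j).castSucc)))))
  | neg φ ih => exact ih.not
  | conj φ ih => exact .iall ih
  | all φ ih =>
    refine .all (.imp (dfn_lev _ _) (ih.congr fun W r v => ?_))
    rw [Fin.snoc_init_self]

/-- Countability of the language makes the conditions over all symbols countable conjunctions. The
sentence obtained here axiomatizes the class of graphs. -/
theorem dfn_codes [Countable L.Symbols] (φ : InfSentence L) :
    Dfn (n := 0) (fun _ r _ => Codes ε r φ) := by
  have : Countable (Σ k, L.Functions k) := Sum.inl_injective (β := Σ k, L.Relations k).countable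
  have : Countable (Σ k, L.Relations k) := Sum.inr_injective (α := Σ k, L.Functions k).countable
  have h : Dfn (n := 0) (fun W r _ =>
      Tower r arity ε ∧
      (∀ (F : Σ k, L.Functions k) (t : Fin F.1 → W), (∀ j, Lev r 0 (t j)) →
        ∃ a, Lev r 0 a ∧ Mk r F.1 (ε (.inl F)) a t) ∧
      (∀ (F : Σ k, L.Functions k) (t : Fin F.1 → W) (a b : W), (∀ j, Lev r 0 (t j)) →
        Lev r 0 a → Lev r 0 b → Mk r F.1 (ε (.inl F)) a t → Mk r F.1 (ε (.inl F)) b t → a = b) ∧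
      (∀ (R : Σ k, L.Relations k) (t : Fin R.1 → W) (a b : W), (∀ j, Lev r 0 (t j)) →
        Lev r 0 a → Lev r 0 b → Mk r R.1 (ε (.inr R)) a t → Mk r R.1 (ε (.inr R)) b t) ∧
      Sat ε r φ default) := by
    refine .and (dfn_tower _ _) (.and ?_ (.and ?_ (.and ?_ ?_)))
    · exact .iall fun F => .allTuple F.1 (.imp (.iall fun j => dfn_lev _ _)
        (.ex (.and (dfn_lev _ _) (dfn_mk _ _ _ (fun j => (Fin.natAdd 0 j).castSucc)))))
    · exact .iall fun F => .allTuple F.1 (.all (.all (.imp (.iall fun j => dfn_lev _ _)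
        (.imp (dfn_lev _ _) (.imp (dfn_lev _ _)
          (.imp (dfn_mk _ _ _ (fun j => (Fin.natAdd 0 j).castSucc.castSucc))
            (.imp (dfn_mk _ _ _ (fun j => (Fin.natAdd 0 j).castSucc.castSucc)) (.eq _ _))))))))
    · exact .iall fun R => .allTuple R.1 (.all (.all (.imp (.iall fun j => dfn_lev _ _)
        (.imp (dfn_lev _ _) (.imp (dfn_lev _ _)
          (.imp (dfn_mk _ _ _ (fun j => (Fin.natAdd 0 j).castSucc.castSucc))
            (dfn_mk _ _ _ (fun j => (Fin.natAdd 0 j).castSucc.castSucc))))))))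
    · refine (dfn_sat ε φ).congr fun W r v => ?_
      rw [Subsingleton.elim v default]
  exact h.congr fun W r _ => ⟨fun ⟨h₁, h₂, h₃, h₄, h₅⟩ => ⟨h₁, h₂, h₃, h₄, h₅⟩,
    fun ⟨h₁, h₂, h₃, h₄, h₅⟩ => ⟨h₁, h₂, h₃, h₄, h₅⟩⟩

end Definability

end GraphCoding

/-! ### Construction of towers -/

namespace GraphCoding

/-- The iterated sets of unordered pairs over `ω`. -/
def PairLevel : ℕ → Type
  | 0 => ℕ
  | n + 1 => Sym2 (PairLevel n)

/-- The nodes of the tower over `ω`. -/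
abbrev PairNode : Type := Σ n, PairLevel n

/-- The node `a` is a member of the node `b`. -/
def Below (a b : PairNode) : Prop :=
  ∃ (n : ℕ) (x : PairLevel n) (p : Sym2 (PairLevel n)), x ∈ p ∧ a = ⟨n, x⟩ ∧ b = ⟨n + 1, p⟩

theorem diag_injective {α : Type} {x y : α} (h : s(x, x) = s(y, y)) : x = y := by
  simpa using h

theorem below_iff {n : ℕ} {x : PairLevel n} {b : PairNode} :
    Below ⟨n, x⟩ b ↔ ∃ p : Sym2 (PairLevel n), x ∈ p ∧ b = ⟨n + 1, p⟩ := by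
  constructor
  · rintro ⟨m, y, p, hy, h, rfl⟩
    cases h
    exact ⟨p, hy, rfl⟩
  · rintro ⟨p, hx, rfl⟩
    exact ⟨n, x, p, hx, rfl, rfl⟩

theorem below_mk_iff {n : ℕ} {x : PairLevel n} {p : Sym2 (PairLevel n)} :
    Below ⟨n, x⟩ ⟨n + 1, p⟩ ↔ x ∈ p := by
  rw [below_iff]
  constructor
  · rintro ⟨q, hx, h⟩
    cases h
    exact hx
  · exact fun h => ⟨p, h, rfl⟩

theorem Below.level {a b : PairNode} (h : Below a b) : b.1 = a.1 + 1 := by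
  obtain ⟨n, x, p, -, rfl, rfl⟩ := h
  rfl

theorem not_below_succ {n : ℕ} {p : PairLevel (n + 1)} {x : PairLevel n} :
    ¬ Below ⟨n + 1, p⟩ ⟨n, x⟩ := by
  intro h
  have := h.level
  simp only at this
  omega

instance nontrivial_pairLevel (n : ℕ) : Nontrivial (PairLevel n) := by
  induction n with
  | zero => exact inferInstanceAs (Nontrivial ℕ)
  | succ n ih =>
    obtain ⟨x, y, hxy⟩ := ih
    exact ⟨s(x, x), s(y, y), fun h => hxy (diag_injective h)⟩

instance countable_pairLevel (n : ℕ) : Countable (PairLevel n) := by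
  induction n with
  | zero => exact inferInstanceAs (Countable ℕ)
  | succ n ih => exact inferInstanceAs (Countable (Sym2 (PairLevel n)))

/-- The graph of nodes, with a leaf attached to each of them. -/
def fullAdj : PairNode ⊕ PairNode → PairNode ⊕ PairNode → Prop
  | .inl a, .inl b => Below a b ∨ Below b a
  | .inl a, .inr b => a = b
  | .inr a, .inl b => a = b
  | .inr _, .inr _ => False

/-- The set of all nodes and of the leaves attached to nodes in `Q`. -/
def vertexSet (Q : PairNode → Prop) : Set (PairNode ⊕ PairNode) := {c | ∀ a, c = .inr a → Q a}

/-- The graph of nodes, with leaves attached to the nodes in `Q`. -/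
def towerAdj (Q : PairNode → Prop) (c d : vertexSet Q) : Prop := fullAdj c.1 d.1

/-! ### Levels, pairs and codes in the concrete tower -/

section Model

variable {Q : PairNode → Prop}

variable (Q) in
/-- A node as a vertex. -/
def nodeVertex (a : PairNode) : vertexSet Q := ⟨.inl a, fun _ h => nomatch h⟩

/-- An attached leaf as a vertex. -/
def leafVertex (a : PairNode) (h : Q a) : vertexSet Q :=
  ⟨.inr a, fun _ hb => Sum.inr_injective hb ▸ h⟩

theorem vertex_cases (c : vertexSet Q) :
    (∃ a, c = nodeVertex Q a) ∨ ∃ a, ∃ h : Q a, c = leafVertex a h := by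
  obtain ⟨a | a, h⟩ := c
  · exact .inl ⟨a, rfl⟩
  · exact .inr ⟨a, h a rfl, rfl⟩

theorem nodeVertex_injective : Function.Injective (nodeVertex Q) :=
  fun _ _ h => Sum.inl_injective (congrArg Subtype.val h)

theorem nodeVertex_mk_injective {n : ℕ} {x y : PairLevel n}
    (h : nodeVertex Q ⟨n, x⟩ = nodeVertex Q ⟨n, y⟩) : x = y :=
  eq_of_heq (Sigma.mk.inj (nodeVertex_injective h)).2

theorem towerAdj_symm {c d : vertexSet Q} (h : towerAdj Q c d) : towerAdj Q d c := by
  obtain ⟨a | a, hc⟩ := c <;> obtain ⟨b | b, hd⟩ := d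
  · exact Or.symm h
  · exact Eq.symm h
  · exact Eq.symm h
  · exact h

theorem adj_nodeVertex {a b : PairNode} :
    towerAdj Q (nodeVertex Q a) (nodeVertex Q b) ↔ Below a b ∨ Below b a := Iff.rfl

theorem adj_mk_iff {n : ℕ} {x : PairLevel n} {p : Sym2 (PairLevel n)} :
    towerAdj Q (nodeVertex Q ⟨n, x⟩) (nodeVertex Q ⟨n + 1, p⟩) ↔ x ∈ p :=
  ⟨fun h => h.elim below_mk_iff.1 fun h => (not_below_succ h).elim, fun h => .inl (below_mk_iff.2 h)⟩

theorem adj_leafVertex {a : PairNode} {h : Q a} {d : vertexSet Q} :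
    towerAdj Q (leafVertex a h) d ↔ d = nodeVertex Q a := by
  rcases vertex_cases d with ⟨b, rfl⟩ | ⟨b, hb, rfl⟩
  · exact ⟨fun h => congrArg _ (Eq.symm h), fun h => (nodeVertex_injective h).symm⟩
  · exact ⟨fun h => h.elim, fun h => nomatch (congrArg Subtype.val h)⟩

theorem leaf_leafVertex (a : PairNode) (h : Q a) : Leaf (towerAdj Q) (leafVertex a h) :=
  ⟨_, adj_leafVertex.2 rfl, fun _ => adj_leafVertex.1⟩

/-- A node `x` has the distinct neighbours `{x}` and `{x, y}` above it, for any `y ≠ x` of its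
level. -/
theorem not_leaf_nodeVertex (a : PairNode) : ¬ Leaf (towerAdj Q) (nodeVertex Q a) := by
  rintro ⟨d, -, hd⟩
  obtain ⟨n, x⟩ := a
  obtain ⟨y, hy⟩ := exists_ne x
  have h : ∀ z, nodeVertex Q ⟨n + 1, s(x, z)⟩ = d := fun z =>
    hd _ (adj_nodeVertex.2 (.inl (below_mk_iff.2 (Sym2.mem_mk_left x z))))
  have hxy : s(x, y) = s(x, x) := nodeVertex_mk_injective (n := n + 1) ((h y).trans (h x).symm)
  exact hy (by simpa using hxy)

theorem not_leaf_iff (c : vertexSet Q) : ¬ Leaf (towerAdj Q) c ↔ ∃ a, c = nodeVertex Q a := by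
  rcases vertex_cases c with ⟨a, rfl⟩ | ⟨a, h, rfl⟩
  · exact iff_of_true (not_leaf_nodeVertex a) ⟨a, rfl⟩
  · exact iff_of_false (not_not.2 (leaf_leafVertex a h))
      fun ⟨b, hb⟩ => nomatch (congrArg Subtype.val hb)

theorem adj_level {a b : PairNode} (h : towerAdj Q (nodeVertex Q a) (nodeVertex Q b)) :
    b.1 = a.1 + 1 ∨ a.1 = b.1 + 1 :=
  (adj_nodeVertex.1 h).imp Below.level Below.level

/-- On level `0` all non-leaf neighbours are pairs `p`, `q` of level `1`, with further common
neighbour `{p, q}`. A node `x = {y, z}` of higher level fails the test at its neighbours `y` and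
`{x, {u}}` with `u ≠ y`: a common neighbour must be a member of the latter containing `y`, hence `x`
itself. -/
theorem lev_zero_nodeVertex {a : PairNode} : Lev (towerAdj Q) 0 (nodeVertex Q a) ↔ a.1 = 0 := by
  obtain ⟨n, x⟩ := a
  constructor
  · rintro ⟨-, h⟩
    rcases n with _ | n
    · rfl
    · exfalso
      induction x using Sym2.ind with
      | _ y z =>
      obtain ⟨u, hu⟩ := exists_ne y
      obtain ⟨w, hw, hwy, hwB⟩ := h (nodeVertex Q ⟨n, y⟩)
        (nodeVertex Q ⟨n + 2, s(s(y, z), s(u, u))⟩)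
        (.inr (below_mk_iff.2 (Sym2.mem_mk_left _ _)))
        (.inl (below_mk_iff (n := n + 1).2 (Sym2.mem_mk_left _ _)))
        (not_leaf_nodeVertex _) (not_leaf_nodeVertex _)
      rcases vertex_cases w with ⟨⟨k, b⟩, rfl⟩ | ⟨b, hb, rfl⟩
      · have h1 := adj_level hwy
        have h2 := adj_level hwB
        obtain rfl : k = n + 1 := by
          simp only at h1 h2
          omega
        change Sym2 (PairLevel n) at b
        have hy : y ∈ b := by
          rcases hwy with h | h
          · exact absurd h not_below_succ
          · exact below_mk_iff.1 h
        have hb : b ∈ s(s(y, z), s(u, u)) := by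
          rcases hwB with h | h
          · exact below_mk_iff.1 h
          · exact absurd h not_below_succ
        rcases Sym2.mem_iff.1 hb with rfl | rfl
        · exact hw rfl
        · exact hu (((Sym2.mem_iff.1 hy).elim id id).symm)
      · have h1 := nodeVertex_injective (adj_leafVertex.1 hwy)
        have h2 := nodeVertex_injective (adj_leafVertex.1 hwB)
        have := congrArg Sigma.fst (h1.trans h2.symm)
        simp at this
  · rintro rfl
    refine ⟨not_leaf_nodeVertex _, fun c d hc hd hc' hd' => ?_⟩
    have key : ∀ c, towerAdj Q (nodeVertex Q ⟨0, x⟩) c → ¬ Leaf (towerAdj Q) c →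
        ∃ p : Sym2 (PairLevel 0), c = nodeVertex Q ⟨1, p⟩ := by
      intro c hc hc'
      obtain ⟨b, rfl⟩ := (not_leaf_iff c).1 hc'
      rcases hc with hc | hc
      · obtain ⟨p, -, rfl⟩ := below_iff.1 hc
        exact ⟨p, rfl⟩
      · exact absurd hc.level (by simp)
    obtain ⟨p, rfl⟩ := key c hc hc'
    obtain ⟨q, rfl⟩ := key d hd hd'
    refine ⟨nodeVertex Q ⟨2, s(p, q)⟩, fun h => ?_, .inr (below_mk_iff (n := 1).2 ?_),
      .inr (below_mk_iff (n := 1).2 ?_)⟩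
    · have := congrArg Sigma.fst (nodeVertex_injective h)
      simp at this
    · exact Sym2.mem_mk_left _ _
    · exact Sym2.mem_mk_right _ _

theorem exists_below {a : PairNode} {n : ℕ} (h : a.1 = n + 1) : ∃ b, b.1 = n ∧ Below b a := by
  obtain ⟨m, x⟩ := a
  obtain rfl : m = n + 1 := h
  induction x using Sym2.ind with
  | _ y z => exact ⟨⟨n, y⟩, rfl, below_mk_iff.2 (Sym2.mem_mk_left y z)⟩

theorem lev_nodeVertex (n : ℕ) : ∀ {a : PairNode}, Lev (towerAdj Q) n (nodeVertex Q a) ↔ a.1 = n := by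
  induction n using Nat.strong_induction_on with
  | _ n ih =>
  intro a
  -- Having a neighbour on level `m` means lying on level `m + 1` or `m - 1`; both possibilities
  -- occur.
  have up : ∀ m, m < n → ((∃ c, Lev (towerAdj Q) m c ∧ towerAdj Q (nodeVertex Q a) c) ↔
      a.1 = m + 1 ∨ m = a.1 + 1) := by
    intro m hm
    constructor
    · rintro ⟨c, hc, hac⟩
      obtain ⟨b, rfl⟩ := (not_leaf_iff c).1 hc.node
      have h1 := (ih m hm).1 hc
      have h2 := adj_level hac
      omega
    · rintro (h | h)
      · obtain ⟨b, hb, hba⟩ := exists_below h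
        exact ⟨nodeVertex Q b, (ih m hm).2 hb, .inr hba⟩
      · obtain ⟨k, x⟩ := a
        refine ⟨nodeVertex Q ⟨k + 1, s(x, x)⟩, (ih m hm).2 h.symm,
          .inl (below_mk_iff.2 (Sym2.mem_mk_left _ _))⟩
  rcases n with _ | _ | n
  · exact lev_zero_nodeVertex
  · refine (and_iff_right (not_leaf_nodeVertex a)).trans ((up 0 (by omega)).trans ?_)
    omega
  · refine (and_iff_right (not_leaf_nodeVertex a)).trans
      ((and_congr (not_congr (ih n (by omega))) (up (n + 1) (by omega))).trans ?_)
    omega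

theorem lev_iff {n : ℕ} {c : vertexSet Q} :
    Lev (towerAdj Q) n c ↔ ∃ x : PairLevel n, c = nodeVertex Q ⟨n, x⟩ := by
  constructor
  · intro h
    obtain ⟨⟨m, x⟩, rfl⟩ := (not_leaf_iff c).1 h.node
    obtain rfl : m = n := (lev_nodeVertex n).1 h
    exact ⟨x, rfl⟩
  · rintro ⟨x, rfl⟩
    exact (lev_nodeVertex n).2 rfl

theorem pr_nodeVertex {n : ℕ} (y z : PairLevel n) :
    Pr (towerAdj Q) (nodeVertex Q ⟨n + 1, s(y, z)⟩) (nodeVertex Q ⟨n, y⟩) (nodeVertex Q ⟨n, z⟩) := by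
  refine ⟨n, (lev_nodeVertex _).2 rfl, (lev_nodeVertex _).2 rfl, (lev_nodeVertex _).2 rfl, ?_⟩
  intro w hw
  obtain ⟨w, rfl⟩ := lev_iff.1 hw
  refine (adj_mk_iff.trans Sym2.mem_iff).trans (or_congr ⟨fun h => h ▸ rfl, nodeVertex_mk_injective⟩
    ⟨fun h => h ▸ rfl, nodeVertex_mk_injective⟩)

theorem exists_of_pr {c d f : vertexSet Q} (h : Pr (towerAdj Q) c d f) :
    ∃ (n : ℕ) (y z : PairLevel n), d = nodeVertex Q ⟨n, y⟩ ∧ f = nodeVertex Q ⟨n, z⟩ ∧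
      c = nodeVertex Q ⟨n + 1, s(y, z)⟩ := by
  obtain ⟨n, hc, hd, hf, h⟩ := h
  obtain ⟨p, rfl⟩ := lev_iff.1 hc
  change Sym2 (PairLevel n) at p
  obtain ⟨y, rfl⟩ := lev_iff.1 hd
  obtain ⟨z, rfl⟩ := lev_iff.1 hf
  refine ⟨n, y, z, rfl, rfl, ?_⟩
  suffices hp : p = s(y, z) by rw [hp]
  refine Sym2.ext fun w => ?_
  refine (adj_mk_iff.symm.trans (h (nodeVertex Q ⟨n, w⟩) (lev_iff.2 ⟨w, rfl⟩))).trans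
    (Iff.trans ?_ Sym2.mem_iff.symm)
  exact or_congr ⟨nodeVertex_mk_injective, fun h => h ▸ rfl⟩
    ⟨nodeVertex_mk_injective, fun h => h ▸ rfl⟩

/-- The iterated singletons of a node. -/
def liftNode {n : ℕ} (x : PairLevel n) : (e : ℕ) → PairLevel (n + e)
  | 0 => x
  | e + 1 => s(liftNode x e, liftNode x e)

/-- The iterated singletons of a node of level `0`. -/
def single (a : ℕ) : (e : ℕ) → PairLevel e
  | 0 => a
  | e + 1 => s(single a e, single a e)

/-- The ordered pair of two nodes. -/
def kurNode {n : ℕ} (x y : PairLevel n) : PairLevel (n + 2) := s(s(x, x), s(x, y))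

/-- The node coding a tuple. -/
def codeNode : (k : ℕ) → ℕ → (Fin k → ℕ) → PairLevel (2 * k)
  | 0, a, _ => a
  | k + 1, a, t => kurNode (codeNode k a (Fin.init t)) (single (t (Fin.last k)) (2 * k))

theorem liftNode_injective {n : ℕ} {x y : PairLevel n} :
    ∀ {e : ℕ}, liftNode x e = liftNode y e → x = y
  | 0, h => h
  | e + 1, h => liftNode_injective (e := e) (diag_injective h)

theorem single_injective {a b : ℕ} : ∀ {e : ℕ}, single a e = single b e → a = b
  | 0, h => h
  | e + 1, h => single_injective (e := e) (diag_injective h)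

theorem kurNode_injective {n : ℕ} {x y x' y' : PairLevel n} (h : kurNode x y = kurNode x' y') :
    x = x' ∧ y = y' := by
  have h' : s(s(x, x), s(x, y)) = s(s(x', x'), s(x', y')) := h
  simp only [Sym2.eq_iff] at h'
  grind

theorem codeNode_injective : ∀ {k : ℕ} {a a' : ℕ} {t t' : Fin k → ℕ},
    codeNode k a t = codeNode k a' t' → a = a' ∧ t = t'
  | 0, _, _, _, _, h => ⟨h, Subsingleton.elim _ _⟩
  | k + 1, a, a', t, t', h => by
    obtain ⟨h₁, h₂⟩ := kurNode_injective h
    obtain ⟨ha, ht⟩ := codeNode_injective h₁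
    refine ⟨ha, ?_⟩
    rw [← Fin.snoc_init_self t, ← Fin.snoc_init_self t', ht, single_injective h₂]

theorem lift_nodeVertex {n : ℕ} (x : PairLevel n) : ∀ e,
    Lift (towerAdj Q) e (nodeVertex Q ⟨n + e, liftNode x e⟩) (nodeVertex Q ⟨n, x⟩)
  | 0 => rfl
  | e + 1 => ⟨_, lift_nodeVertex x e, pr_nodeVertex _ _⟩

theorem lift_single (a : ℕ) : ∀ e,
    Lift (towerAdj Q) e (nodeVertex Q ⟨e, single a e⟩) (nodeVertex Q ⟨0, a⟩)
  | 0 => rfl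
  | e + 1 => ⟨_, lift_single a e, pr_nodeVertex _ _⟩

theorem kur_nodeVertex {n : ℕ} (x y : PairLevel n) :
    Kur (towerAdj Q) (nodeVertex Q ⟨n + 2, kurNode x y⟩) (nodeVertex Q ⟨n, x⟩)
      (nodeVertex Q ⟨n, y⟩) :=
  ⟨_, _, pr_nodeVertex x x, pr_nodeVertex x y, pr_nodeVertex (n := n + 1) s(x, x) s(x, y)⟩

theorem code_nodeVertex (a : ℕ) : ∀ {k : ℕ} (t : Fin k → ℕ),
    Code (towerAdj Q) k (nodeVertex Q ⟨2 * k, codeNode k a t⟩) (nodeVertex Q ⟨0, a⟩)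
      (fun j => nodeVertex Q ⟨0, t j⟩)
  | 0, _ => rfl
  | _ + 1, t => ⟨_, _, code_nodeVertex a (Fin.init t), lift_single _ _, kur_nodeVertex _ _⟩

theorem node_nodeVertex (k e a : ℕ) (t : Fin k → ℕ) :
    Node (towerAdj Q) k e (nodeVertex Q ⟨2 * k + e, liftNode (codeNode k a t) e⟩)
      (nodeVertex Q ⟨0, a⟩) (fun j => nodeVertex Q ⟨0, t j⟩) :=
  ⟨_, code_nodeVertex a t, lift_nodeVertex _ e⟩

theorem marked_iff {c : vertexSet Q} :
    Marked (towerAdj Q) c ↔ ∃ a, c = nodeVertex Q a ∧ Q a := by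
  constructor
  · rintro ⟨l, hl, hlc⟩
    rcases vertex_cases l with ⟨a, rfl⟩ | ⟨a, ha, rfl⟩
    · exact absurd hl (not_leaf_nodeVertex a)
    · exact ⟨a, adj_leafVertex.1 hlc, ha⟩
  · rintro ⟨a, rfl, ha⟩
    exact ⟨leafVertex a ha, leaf_leafVertex a ha, adj_leafVertex.2 rfl⟩

end Model

/-! ### Towers with prescribed marks -/

section Marks

variable {ι : Type} (ar ε : ι → ℕ) (P : (i : ι) → ℕ → (Fin (ar i) → ℕ) → Prop)

/-- The nodes coding the tuples in the predicates `P`. -/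
def marks (x : PairNode) : Prop :=
  ∃ (i : ι) (a : ℕ) (t : Fin (ar i) → ℕ),
    P i a t ∧ x = ⟨2 * ar i + ε i, liftNode (codeNode (ar i) a t) (ε i)⟩

theorem tower_marks : Tower (towerAdj (marks ar ε P)) ar ε where
  symm _ _ := towerAdj_symm
  irrefl c h := by
    rcases vertex_cases c with ⟨a, rfl⟩ | ⟨a, ha, rfl⟩
    · rcases h with h | h <;> exact absurd h.level (by simp)
    · exact h
  not_leaf c d hc hcd := by
    rcases vertex_cases c with ⟨a, rfl⟩ | ⟨a, ha, rfl⟩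
    · exact absurd hc (not_leaf_nodeVertex a)
    · exact (not_leaf_iff _).2 ⟨a, adj_leafVertex.1 hcd⟩
  leaf_unique c d f hc hd hcf hdf := by
    rcases vertex_cases c with ⟨a, rfl⟩ | ⟨a, ha, rfl⟩
    · exact absurd hc (not_leaf_nodeVertex a)
    rcases vertex_cases d with ⟨b, rfl⟩ | ⟨b, hb, rfl⟩
    · exact absurd hd (not_leaf_nodeVertex b)
    obtain rfl := nodeVertex_injective ((adj_leafVertex.1 hcf).symm.trans (adj_leafVertex.1 hdf))
    rfl
  exists_lev c hc := by
    obtain ⟨a, rfl⟩ := (not_leaf_iff c).1 hc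
    exact ⟨a.1, (lev_nodeVertex _).2 rfl⟩
  lev_unique n m c hn hm := by
    obtain ⟨a, rfl⟩ := (not_leaf_iff c).1 hn.node
    exact ((lev_nodeVertex n).1 hn).symm.trans ((lev_nodeVertex m).1 hm)
  lev_adj n m c d hc hd h := by
    obtain ⟨x, rfl⟩ := lev_iff.1 hc
    obtain ⟨y, rfl⟩ := lev_iff.1 hd
    exact adj_level h
  exists_pr n c d hc hd := by
    obtain ⟨x, rfl⟩ := lev_iff.1 hc
    obtain ⟨y, rfl⟩ := lev_iff.1 hd
    exact ⟨_, pr_nodeVertex x y⟩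
  pr_unique c c' d f h h' := by
    obtain ⟨n, y, z, rfl, rfl, rfl⟩ := exists_of_pr h
    obtain ⟨m, y', z', hy, hz, rfl⟩ := exists_of_pr h'
    obtain rfl : n = m := congrArg Sigma.fst (nodeVertex_injective hy)
    rw [nodeVertex_mk_injective hy, nodeVertex_mk_injective hz]
  exists_eq_pr n c hc := by
    obtain ⟨x, rfl⟩ := lev_iff.1 hc
    induction x using Sym2.ind with
    | _ y z => exact ⟨_, _, pr_nodeVertex y z⟩
  infinite _ t := by
    by_contra! h
    choose j hj using fun m : ℕ => h (nodeVertex _ ⟨0, m⟩) ((lev_nodeVertex _).2 rfl)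
    exact not_injective_infinite_finite j fun m m' hm =>
      nodeVertex_mk_injective ((hj m).trans ((congrArg t hm).trans (hj m').symm))
  marked c hc := by
    obtain ⟨_, rfl, i, a, t, -, rfl⟩ := marked_iff.1 hc
    exact ⟨i, _, _, (lev_nodeVertex _).2 rfl, fun j => (lev_nodeVertex _).2 rfl,
      node_nodeVertex (ar i) (ε i) a t⟩

variable {ar ε}

/-- By `hε` the level of a marked node determines the index `i`; injectivity of iterated singletons
and of codes then recovers the tuple, so no mark is ambiguous. -/
theorem decodes_marks (hε : Function.Injective fun i => 2 * ar i + ε i) :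
    Decodes (towerAdj (marks ar ε P)) ar ε P (fun m => nodeVertex _ ⟨0, m⟩) where
  injective _ _ h := nodeVertex_mk_injective h
  lev_zero c := lev_iff.trans (exists_congr fun _ => eq_comm)
  mk_iff i a t := by
    constructor
    · rintro ⟨c, hc, hm⟩
      obtain rfl := (tower_marks ar ε P).node_unique hc (node_nodeVertex _ _ a t)
      obtain ⟨b, hb, i', a', t', hP, rfl⟩ := marked_iff.1 hm
      have h := nodeVertex_injective hb
      obtain rfl : i = i' := hε (congrArg Sigma.fst h)
      obtain ⟨rfl, rfl⟩ :=
        codeNode_injective (liftNode_injective (nodeVertex_mk_injective hb))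
      exact hP
    · exact fun h => ⟨_, node_nodeVertex _ _ a t, marked_iff.2 ⟨_, rfl, i, a, t, h, rfl⟩⟩

end Marks

end GraphCoding

/-! ### Encoding and decoding of structures -/

namespace GraphCoding

open FirstOrder

/-! ### Borel enumeration of infinite subsets of `ω` -/

section Enumeration

variable {Y : Type*} [MeasurableSpace Y] {p : Y → ℕ → Prop}

open Classical in
theorem measurable_count (hp : ∀ n, Measurable fun y => p y n) (a : ℕ) :
    Measurable fun y => Nat.count (p y) a := by
  induction a with
  | zero => simp
  | succ a ih =>
    simp only [Nat.count_succ]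
    exact ih.add (Measurable.ite (measurableSet_setOfPred.2 (hp a)) measurable_const
      measurable_const)

/-- The `n`-th element is `a` exactly when `a` belongs to the set and has `n` predecessors in it, a
condition on finitely many values of `p`. -/
theorem measurable_nth (hp : ∀ n, Measurable fun y => p y n)
    (hinf : ∀ y, {n | p y n}.Infinite) (n : ℕ) : Measurable fun y => Nat.nth (p y) n := by
  classical
  refine measurable_to_countable' fun a => ?_
  have : (fun y => Nat.nth (p y) n) ⁻¹' {a} = {y | p y a ∧ Nat.count (p y) a = n} := by
    ext y
    constructor
    · rintro rfl
      exact ⟨Nat.nth_mem_of_infinite (hinf y) n, Nat.count_nth_of_infinite (hinf y) n⟩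
    · rintro ⟨h, rfl⟩
      exact Nat.nth_count h
  rw [this]
  exact measurableSet_setOfPred.2 ((hp a).and
    (measurableSet_setOfPred.1 (measurable_count hp a (measurableSet_singleton n))))

/-- The increasing enumeration of an infinite set of natural numbers, as a bijection. -/
theorem bijective_nth {q : ℕ → Prop} (hq : {n | q n}.Infinite) :
    Function.Bijective (fun n => (⟨Nat.nth q n, Nat.nth_mem_of_infinite hq n⟩ : {a // q a})) := by
  refine ⟨fun a b h => Nat.nth_injective hq (congrArg Subtype.val h), fun ⟨a, ha⟩ => ?_⟩
  have : a ∈ Set.range (Nat.nth q) := by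
    rw [Nat.range_nth_of_infinite hq]
    exact ha
  obtain ⟨n, hn⟩ := this
  exact ⟨n, Subtype.ext hn⟩

end Enumeration

/-! ### Transport of codings along isomorphisms -/

section Transfer

variable {W W' : Type} {r : W → W → Prop} {r' : W' → W' → Prop}

/-- Levels and marks are definable, hence invariant under isomorphism of graphs. -/
theorem Decodes.map {ι M : Type} {ar ε : ι → ℕ} {P : (i : ι) → M → (Fin (ar i) → M) → Prop}
    {e : M → W} (D : Decodes r ar ε P e) (α : r ≃r r') :
    Decodes r' ar ε P (fun m => α (e m)) where
  injective := α.injective.comp D.injective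
  lev_zero x := by
    have h := (dfn_lev 0 (0 : Fin 1)).invariant α (fun _ => α.symm x)
    simp only [RelIso.apply_symm_apply] at h
    rw [h, D.lev_zero]
    exact exists_congr fun m => ⟨fun hm => by rw [hm, RelIso.apply_symm_apply],
      fun hm => by rw [← hm, RelIso.symm_apply_apply]⟩
  mk_iff i a t := by
    rw [← D.mk_iff]
    exact (dfn_mk (ar i) (ε i) 0 Fin.succ).invariant α (Fin.cons (e a) fun j => e (t j))

theorem Codes.map {L : FirstOrder.Language.{0, 0}} [Countable L.Symbols] {ε : L.Symbols → ℕ}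
    {φ : InfSentence L} (h : Codes ε r φ) (α : r ≃r r') : Codes ε r' φ :=
  ((dfn_codes ε φ).invariant α default).2 h

theorem holds_equiv {L : FirstOrder.Language.{0, 0}} {M M' : Type} {S : L.Structure M}
    {S' : L.Structure M'} (β : M ≃[L] M') (s : L.Symbols) (a : M) (t : Fin (arity s) → M) :
    Holds S' s (β a) (fun j => β (t j)) ↔ Holds S s a t := by
  rcases s with F | R
  · change S'.funMap F.2 (β ∘ t) = β a ↔ S.funMap F.2 t = a
    rw [← β.map_fun]
    exact β.injective.eq_iff
  · exact β.map_rel R.2 t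

theorem Decodes.comp_equiv {L : FirstOrder.Language.{0, 0}} {ε : L.Symbols → ℕ} {M M' : Type}
    {S : L.Structure M} {S' : L.Structure M'} {e : M' → W}
    (D : Decodes r arity ε (Holds S') e) (β : M ≃[L] M') :
    Decodes r arity ε (Holds S) (fun m => e (β m)) where
  injective := D.injective.comp β.injective
  lev_zero x := (D.lev_zero x).trans β.surjective.exists
  mk_iff s a t := (D.mk_iff s (β a) (fun j => β (t j))).trans (holds_equiv β s a t)

end Transfer

/-! ### The Borel maps between structures and towers -/

section Coding

variable {L : FirstOrder.Language.{0, 0}} (ε : L.Symbols → ℕ)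

/-- The nodes to be marked in the tower coding a structure. -/
abbrev structureMarks (S : ModSpace L) : PairNode → Prop := marks arity ε (Holds S)

instance infinite_pairNode : Infinite PairNode :=
  Infinite.of_injective (fun a : ℕ => (⟨0, a⟩ : PairNode))
    fun _ _ h => eq_of_heq (Sigma.mk.inj h).2

/-- An enumeration of all nodes and of the leaves attached to them. -/
noncomputable def vertexEquiv : PairNode ⊕ PairNode ≃ ℕ :=
  Classical.choice nonempty_equiv_of_countable

/-- The numbers of the vertices of the tower coding a structure. -/
def VertexNumber (S : ModSpace L) (n : ℕ) : Prop :=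
  vertexEquiv.symm n ∈ vertexSet (structureMarks ε S)

theorem infinite_vertexNumber (S : ModSpace L) : {n | VertexNumber ε S n}.Infinite := by
  refine Set.infinite_of_injective_forall_mem (f := fun a => vertexEquiv (Sum.inl a))
    (fun _ _ h => Sum.inl_injective (vertexEquiv.injective h)) fun a => ?_
  change vertexEquiv.symm (vertexEquiv (Sum.inl a)) ∈ vertexSet (structureMarks ε S)
  rw [Equiv.symm_apply_apply]
  exact (nodeVertex _ a).2

/-- The tower coding a structure, with vertex set `ω`. -/
noncomputable def encode (S : ModSpace L) : ModSpace Language.graph :=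
  relStructure fun a b => fullAdj (vertexEquiv.symm (Nat.nth (VertexNumber ε S) a))
    (vertexEquiv.symm (Nat.nth (VertexNumber ε S) b))

theorem nonempty_relIso_encode (S : ModSpace L) :
    Nonempty (towerAdj (structureMarks ε S) ≃r edge (encode ε S)) :=
  ⟨RelIso.symm {
    toEquiv := (Equiv.ofBijective _ (bijective_nth (infinite_vertexNumber ε S))).trans
      (vertexEquiv.symm.subtypeEquiv fun _ => Iff.rfl)
    map_rel_iff' := Iff.rfl }⟩

/-- The structure coded by a graph, with domain `ω`. -/
noncomputable def decode (G : ModSpace Language.graph) : ModSpace L :=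
  decodeStructure ε (edge G) (Nat.nth (Lev (edge G) 0))

/-- The graph `G` codes the structure `S`. -/
def IsCode (S : ModSpace L) (G : ModSpace Language.graph) : Prop :=
  Tower (edge G) arity ε ∧ ∃ e, Decodes (edge G) arity ε (Holds S) e

variable {ε}

/-- Transporting along the isomorphism makes one graph code both structures. Together with its
converse below, this shows that `IsCode` respects isomorphism on both sides, so encoding and
decoding need only produce related pairs. -/
theorem IsCode.isomorphic_structure {S S' : ModSpace L} {G G' : ModSpace Language.graph}
    (h : IsCode ε S G) (h' : IsCode ε S' G') (hG : G.Isomorphic G') : S.Isomorphic S' := by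
  obtain ⟨α⟩ := (isomorphic_iff G G').1 hG
  obtain ⟨-, e, D⟩ := h
  obtain ⟨-, e', D'⟩ := h'
  exact (D.map α).nonempty_equiv D'

theorem IsCode.isomorphic_graph {S S' : ModSpace L} {G G' : ModSpace Language.graph}
    (h : IsCode ε S G) (h' : IsCode ε S' G') (hS : S.Isomorphic S') : G.Isomorphic G' := by
  obtain ⟨β⟩ := hS
  obtain ⟨T, e, D⟩ := h
  obtain ⟨T', e', D'⟩ := h'
  exact (isomorphic_iff G G').2 (T.nonempty_relIso T' D (D'.comp_equiv β))

theorem isCode_encode (hε : Function.Injective fun s : L.Symbols => 2 * arity s + ε s)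
    [Countable L.Symbols] (S : ModSpace L) : IsCode ε S (encode ε S) := by
  obtain ⟨α⟩ := nonempty_relIso_encode ε S
  exact ⟨((dfn_tower (n := 0) arity ε).invariant α default).2 (tower_marks arity ε (Holds S)),
    _, (decodes_marks (Holds S) hε).map α⟩

theorem codes_encode (hε : Function.Injective fun s : L.Symbols => 2 * arity s + ε s)
    [Countable L.Symbols] {S : ModSpace L} {φ : InfSentence L} (h : S.Models φ) :
    Codes ε (edge (encode ε S)) φ := by
  obtain ⟨T, e, D⟩ := isCode_encode hε S
  exact D.codes T h

theorem Tower.infinite_lev_zero {ι : Type} {ar ε : ι → ℕ} {W : Type} {r : W → W → Prop}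
    (T : Tower r ar ε) : {x | Lev r 0 x}.Infinite := by
  intro h
  obtain ⟨k, t, -, ht⟩ := h.fin_param
  obtain ⟨a, ha, hat⟩ := T.infinite k t
  have : a ∈ Set.range t := ht ▸ ha
  obtain ⟨j, hj⟩ := this
  exact hat j hj.symm

theorem Codes.decodes_decode {φ : InfSentence L} {G : ModSpace Language.graph}
    (h : Codes ε (edge G) φ) :
    Decodes (edge G) arity ε (Holds (decode ε G)) (Nat.nth (Lev (edge G) 0)) := by
  have hinf := h.tower.infinite_lev_zero
  refine h.decodes (Nat.nth_injective hinf) fun x => ?_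
  exact (Set.ext_iff.1 (Nat.range_nth_of_infinite hinf) x).symm

theorem Codes.isCode_decode {φ : InfSentence L} {G : ModSpace Language.graph}
    (h : Codes ε (edge G) φ) : IsCode ε (decode ε G) G :=
  ⟨h.tower, _, h.decodes_decode⟩

theorem Codes.models_decode {φ : InfSentence L} {G : ModSpace Language.graph}
    (h : Codes ε (edge G) φ) : (decode ε G : ModSpace L).Models φ := by
  refine (h.decodes_decode.sat_iff φ default).1 ?_
  convert h.sat

theorem measurable_holds (s : L.Symbols) (a : ℕ) (t : Fin (arity s) → ℕ) :
    Measurable fun S : ModSpace L => Holds S s a t := by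
  rcases s with F | R
  · exact measurableSet_setOfPred.1 (measurableSet_funMap F.2 t a)
  · exact measurableSet_setOfPred.1 (measurableSet_relMap R.2 t)

/-- All potential vertices are numbered once and for all. Only the set of numbers in use depends on
`S`, in a Borel way, and adjacency is a fixed relation between numbers. -/
theorem measurable_encode [Countable L.Symbols] :
    Measurable (encode ε : ModSpace L → ModSpace Language.graph) := by
  have hmarks : ∀ x, Measurable fun S : ModSpace L => structureMarks ε S x := fun x =>
    .exists fun s => .exists fun a => .exists fun t => (measurable_holds s a t).and measurable_const
  have hvert : ∀ n, Measurable fun S : ModSpace L => VertexNumber ε S n := fun n =>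
    .forall fun a => .imp measurable_const (hmarks a)
  have hnth := measurable_nth hvert (infinite_vertexNumber ε)
  refine measurable_modSpace (fun k F => nomatch F) fun k R t => ?_
  cases R
  exact measurableSet_setOfPred.2 ((measurable_of_countable (fun n : ℕ × ℕ =>
    fullAdj (vertexEquiv.symm n.1) (vertexEquiv.symm n.2))).comp
      ((hnth (t 0)).prodMk (hnth (t 1))))

theorem measurable_decode [Countable L.Symbols] {φ : InfSentence L}
    {ψ : InfSentence Language.graph} (hψ : ∀ G : ModSpace Language.graph,
      G.Models ψ → Codes ε (edge G) φ) :
    Measurable fun G : ElementaryClass ψ => (decode ε G.1 : ModSpace L) := by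
  have hlev : ∀ n, Measurable fun G : ElementaryClass ψ => Lev (edge G.1) 0 n := fun n =>
    (measurableSet_setOfPred.1 ((dfn_lev 0 (0 : Fin 1)).measurableSet fun _ => n)).comp
      measurable_subtype_coe
  have hnth := measurable_nth hlev fun G => (hψ G.1 G.2).tower.infinite_lev_zero
  have hmk : ∀ (k e a : ℕ) (t : Fin k → ℕ), Measurable fun G : ElementaryClass ψ =>
      Mk (edge G.1) k e (Nat.nth (Lev (edge G.1) 0) a)
        (fun j => Nat.nth (Lev (edge G.1) 0) (t j)) := by
    intro k e a t
    -- The arguments of `Mk` vary with `G`; splitting over their countably many values leaves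
    -- conditions at fixed vertices.
    have : Measurable fun G : ElementaryClass ψ => ∃ (b : ℕ) (u : Fin k → ℕ),
        Nat.nth (Lev (edge G.1) 0) a = b ∧ (∀ j, Nat.nth (Lev (edge G.1) 0) (t j) = u j) ∧
          Mk (edge G.1) k e b u := by
      refine .exists fun b => .exists fun u => .and ?_ (.and (.forall fun j => ?_) ?_)
      · exact measurableSet_setOfPred.1 (hnth a (measurableSet_singleton b))
      · exact measurableSet_setOfPred.1 (hnth (t j) (measurableSet_singleton (u j)))
      · exact (measurableSet_setOfPred.1
          ((dfn_mk k e 0 Fin.succ).measurableSet (Fin.cons b u : Fin (k + 1) → ℕ))).comp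
            measurable_subtype_coe
    convert this using 3 with G
    constructor
    · exact fun h => ⟨_, _, rfl, fun _ => rfl, h⟩
    · rintro ⟨b, u, rfl, hu, h⟩
      rwa [funext hu]
  refine measurable_modSpace (fun k F t a => ?_) fun k R t => ?_
  · convert measurableSet_setOfPred.2 (hmk k (ε (.inl ⟨k, F⟩)) a t) using 3 with G
    exact (hψ G.1 G.2).decodes_decode.mk_iff (.inl ⟨k, F⟩) a t |>.symm
  · exact measurableSet_setOfPred.2 (.exists fun a => hmk k (ε (.inr ⟨k, R⟩)) a t)

end Coding

/-- Since `Nat.pair m c ≥ m`, the padding can raise `2 * arity s` to `Nat.pair (2 * arity s) (c s)`,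
which determines `s`. -/
theorem exists_level (L : FirstOrder.Language.{0, 0}) [Countable L.Symbols] :
    ∃ ε : L.Symbols → ℕ, Function.Injective fun s : L.Symbols => 2 * arity s + ε s := by
  obtain ⟨c, hc⟩ := exists_injective_nat L.Symbols
  refine ⟨fun s => Nat.pair (2 * arity s) (c s) - 2 * arity s, fun s s' h => ?_⟩
  simp only [Nat.add_sub_cancel' (Nat.left_le_pair _ _)] at h
  exact hc (Nat.pair_eq_pair.1 h).2

/-- Every elementary class of countable structures is classwise Borel isomorphic to an elementary
class of connected graphs any two of which are weak-epimorphic images of each other. -/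
theorem exists_elementaryClass_connected_graphs (L : FirstOrder.Language.{0, 0})
    [Countable L.Symbols] (φ : InfSentence L) :
    ∃ ψ : InfSentence Language.graph,
      (∀ S : ModSpace Language.graph, S.Models ψ → S.IsConnectedGraph) ∧
      (∀ S T : ModSpace Language.graph, S.Models ψ → T.Models ψ → S.WeakEpiImage T) ∧
      ClasswiseBorelIsomorphic (isoRel φ) (isoRel ψ) := by
  obtain ⟨ε, hε⟩ := exists_level L
  obtain ⟨ψ, hψ⟩ := dfn_codes ε φ
  have models : ∀ G : ModSpace Language.graph, G.Models ψ ↔ Codes ε (edge G) φ := by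
    intro G
    have h := hψ ℕ (edge G) default
    rwa [relStructure_edge] at h
  refine ⟨ψ, fun S hS => isConnectedGraph_of_tower ((models S).1 hS).tower,
    fun S T hS hT => weakEpiImage_of_tower ((models S).1 hS).tower ((models T).1 hT).tower, ?_⟩
  let f : ElementaryClass φ → ElementaryClass ψ := fun S =>
    ⟨encode ε S.1, (models _).2 (codes_encode hε S.2)⟩
  let g : ElementaryClass ψ → ElementaryClass φ := fun G =>
    ⟨decode ε G.1, ((models _).1 G.2).models_decode⟩
  -- These two facts yield everything but measurability: `f S` codes both `S` and `g (f S)`, while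
  -- `g G` is coded by both `G` and `f (g G)`.
  have hf : ∀ S, IsCode ε S.1 (f S).1 := fun S => isCode_encode hε S.1
  have hg : ∀ G, IsCode ε (g G).1 G.1 := fun G => ((models _).1 G.2).isCode_decode
  refine ⟨f, g, (measurable_encode.comp measurable_subtype_coe).subtype_mk,
    (measurable_decode fun G => (models G).1).subtype_mk, fun S S' => ?_, fun G G' => ?_,
    fun S => ?_, fun G => ?_⟩
  · exact ⟨(hf S).isomorphic_graph (hf S'), (hf S).isomorphic_structure (hf S')⟩
  · exact ⟨(hg G).isomorphic_structure (hg G'), (hg G).isomorphic_graph (hg G')⟩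
  · exact (hg (f S)).isomorphic_structure (hf S) ((isoRel ψ).refl (f S))
  · exact (hf (g G)).isomorphic_graph (hg G) ((isoRel φ).refl (g G))

end GraphCoding

/-! ### Composition of reductions and conclusion -/

theorem BorelReducible.trans {X Y Z : Type*} [MeasurableSpace X] [MeasurableSpace Y]
    [MeasurableSpace Z] {E : Setoid X} {F : Setoid Y} {G : Setoid Z} (h : BorelReducible E F)
    (h' : BorelReducible F G) : BorelReducible E G := by
  obtain ⟨f, hf, hEF⟩ := h
  obtain ⟨g, hg, hFG⟩ := h'
  exact ⟨g ∘ f, hg.comp hf, fun x y => (hEF x y).trans (hFG _ _)⟩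

theorem ClasswiseBorelIsomorphic.borelBireducible {X Y : Type*} [MeasurableSpace X]
    [MeasurableSpace Y] {E : Setoid X} {F : Setoid Y} (h : ClasswiseBorelIsomorphic E F) :
    BorelBireducible E F := by
  obtain ⟨f, g, hf, hg, hEF, hFE, -, -⟩ := h
  exact ⟨⟨f, hf, hEF⟩, ⟨g, hg, hFE⟩⟩

theorem ClasswiseBorelIsomorphic.comp_measurableEquiv {X Y Z : Type*} [MeasurableSpace X]
    [MeasurableSpace Y] [MeasurableSpace Z] {E : Setoid X} {F : Setoid Y} {G : Setoid Z}
    (e : X ≃ᵐ Y) (he : ∀ x y, E x y ↔ F (e x) (e y)) (h : ClasswiseBorelIsomorphic F G) :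
    ClasswiseBorelIsomorphic E G := by
  obtain ⟨f, g, hf, hg, hFG, hGF, hgf, hfg⟩ := h
  refine ⟨f ∘ e, e.symm ∘ g, hf.comp e.measurable, e.symm.measurable.comp hg,
    fun x y => (he x y).trans (hFG _ _), fun z z' => (hGF z z').trans ?_, fun x => ?_, fun z => ?_⟩
  · simp [he]
  · simpa [he] using hgf (e x)
  · simpa using hfg z

theorem corollary4p2 {X : Type*} [MeasurableSpace X] [StandardBorelSpace X] (E : Setoid X)
    (hE : IsQuasiIsomorphismRelation E) :
    ∃ φ : InfSentence FirstOrder.Language.graph,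
      (∀ S : ModSpace FirstOrder.Language.graph, S.Models φ → S.IsConnectedGraph) ∧
      BorelBireducible E (isoRel φ) ∧
      (∀ S T : ModSpace FirstOrder.Language.graph,
        S.Models φ → T.Models φ → S.WeakEpiImage T) ∧
      (IsIsomorphismRelation E → ClasswiseBorelIsomorphic E (isoRel φ)) := by
  -- One sentence must serve all clauses, so an isomorphism relation is treated through its own
  -- elementary class, not through a merely bireducible one.
  by_cases hiso : IsIsomorphismRelation E
  · obtain ⟨L, _, φ, e, he⟩ := hiso
    obtain ⟨ψ, hconn, hepi, h⟩ := GraphCoding.exists_elementaryClass_connected_graphs L φ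
    have h' := h.comp_measurableEquiv e he
    exact ⟨ψ, hconn, h'.borelBireducible, hepi, fun _ => h'⟩
  · obtain ⟨L, _, φ, hred, hred'⟩ := hE
    obtain ⟨ψ, hconn, hepi, h⟩ := GraphCoding.exists_elementaryClass_connected_graphs L φ
    exact ⟨ψ, hconn, ⟨hred.trans h.borelBireducible.1, h.borelBireducible.2.trans hred'⟩, hepi,
      fun h => absurd h hiso⟩
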